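/- An interval-poset of size $n$ is a partial order $\vartriangleleft$ on $\{1,\dots,n\}$ such that for all $a<b<c$: $a\vartriangleleft c$ implies $b\vartriangleleft c$, and $c\vartriangleleft a$ implies $b\vartriangleleft a$. (The empty interval-poset, of size $0$, is allowed.) A relation $a\vartriangleleft b$ is increasing if $a<b$ and decreasing if $a>b$. The decreasing relations of $I$ form a forest, the final forest of $I$ (if $b\vartriangleleft a$ and $b>a$, then $b$ is a descendant of $a$); $\mathrm{trees}(I)$ denotes the number of its components, i.e. of its roots. The initial rise $\mathrm{ir}(I)$ is the largest $k\in\{0,\dots,\mathrm{size}(I)\}$ such that there is no relation $j-1\vartriangleleft j$ with $2\le j\le k$. Lower contacts composition. Let $I_1,I_2$ be interval-posets, $0\le r\le \mathrm{trees}(I_2)$, and let $x_1<x_2<\cdots$ be the roots of the final forest of $I_2$. Then $LC(I_1,I_2,r)$ is the interval-poset of size $\mathrm{size}(I_1)+1+\mathrm{size}(I_2)$ obtained by the shifted concatenation of $I_1$, a new vertex $k$, and $I_2$, by adding the relations $y\vartriangleleft k$ for all $y$ in $I_1$ and $x_i\vartriangleleft k$ for $1\le i\le r$ and taking the transitive closure.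 Initial rise composition. Let $I_1,I_2$ be interval-posets and $0\le r\le \mathrm{ir}(I_2)$. First form $I_2'$ from $I_2$ by inserting a new vertex with label $k=\mathrm{ir}(I_2)-r+1$ (the labels $\ge k$ of $I_2$ are increased by $1$); the increasing relations of $I_2'$ are those of $I_2$ together with $k\vartriangleleft k+1$ if $k+1\le \mathrm{size}(I_2')$ (and what follows by transitivity), and its decreasing relations are those of the unique final forest in which every former vertex has the same number of children as in the final forest of $I_2$ and the new vertex has no child. Then let $a=\mathrm{ir}(I_1)$ and insert $I_2'$ into $I_1$ right after the label $a$ (the vertices of $I_2'$ are shifted by $a$, the vertices of $I_1$ larger than $a$ by $\mathrm{size}(I_2')$); add $j\vartriangleleft a$ for all $j$ in $I_2'$ if $I_1$ is not empty, add $j\vartriangleleft a+1+\mathrm{size}(I_2')$ for all $j$ in $I_2'$ if $a\neq\mathrm{size}(I_1)$, and take the transitive closure. The result is the interval-poset $IR(I_1,I_2,r)$. Let $I$ be a non-empty interval-poset, $k$ its largest label such that $i\vartriangleleft k$ for all $i<k$, $I_1$ and $I_2$ the (relabelled) subposets of $I$ on the labels $<k$ and $>k$, and $r$ the number of children of $k$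 in the final forest of $I$. Define recursively $\beta(\emptyset)=\emptyset$ and $\beta(I)=IR(\beta(I_1),\beta(I_2),r)$. Theorem. (1) Every non-empty interval-poset $I$ can be written as $I=LC(I_1,I_2,r)$ with $0\le r\le\mathrm{trees}(I_2)$ for exactly one triple $(I_1,I_2,r)$. For all interval-posets $I_1,I_2$ and all $0\le r\le\mathrm{trees}(I_2)$ we have $r\le\mathrm{ir}(\beta(I_2))$ and $\beta(LC(I_1,I_2,r))=IR(\beta(I_1),\beta(I_2),r)$; moreover $\beta(\emptyset)=\emptyset$. (2) For every $n$, $\beta$ restricts to a bijection of the set of interval-posets of size $n$ onto itself. (3) For every interval-poset $I$, $\mathrm{trees}(\beta(I))=\mathrm{ir}(I)$ and $\mathrm{ir}(\beta(I))=\mathrm{trees}(I)$. (4) Consequently, the generating function $\Phi(y;x,z)=\sum_I y^{\mathrm{size}(I)}x^{\mathrm{trees}(I)}z^{\mathrm{ir}(I)}$, where $I$ runs over all interval-posets, is symmetric: $\Phi(y;x,z)=\Phi(y;z,x)$ as formal power series in $y$, for all $x,z$ in any commutative semiring (in particular for indeterminates $x,z$). -/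

import Mathlib

/-- An interval-poset: a partial order `⊲` (here `le a b` means `a ⊲ b` or `a = b`) on the labels
`1, …, size` such that for all labels `a < b < c`, `a ⊲ c` implies `b ⊲ c`, and `c ⊲ a` implies
`b ⊲ a`. The relation is false as soon as one of its arguments is not a label, so that two
interval-posets are equal exactly when they have the same size and the same relations. -/
@[ext]
structure IntervalPoset where
  size : ℕ
  le : ℕ → ℕ → Prop
  mem_of_le : ∀ a b, le a b → (1 ≤ a ∧ a ≤ size) ∧ (1 ≤ b ∧ b ≤ size)
  refl : ∀ a, 1 ≤ a → a ≤ size → le a a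
  antisymm : ∀ a b, le a b → le b a → a = b
  trans : ∀ a b c, le a b → le b c → le a c
  increasing : ∀ a b c, a < b → b < c → le a c → le b c
  decreasing : ∀ a b c, a < b → b < c → le c a → le b a

namespace IntervalPoset

/-- Vertex `x` is a root of the final forest of `I` (the forest of the decreasing relations
`x ⊲ a`, `a < x`). -/
def IsRoot (I : IntervalPoset) (x : ℕ) : Prop :=
  1 ≤ x ∧ x ≤ I.size ∧ ∀ a, a < x → ¬ I.le x a

/-- `j` is a child of `k` in the final forest of `I`: `j ⊲ k` is a decreasing relation, and no
vertex `i` lies strictly between them for the decreasing relations. -/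
def IsChild (I : IntervalPoset) (j k : ℕ) : Prop :=
  k < j ∧ I.le j k ∧ ∀ i, k < i → i < j → ¬ (I.le j i ∧ I.le i k)

open Classical in
/-- The number of roots of the final forest that have a label at most `w`. -/
noncomputable def rootsUpTo (I : IntervalPoset) (w : ℕ) : ℕ :=
  ((Finset.Icc 1 w).filter fun x => I.IsRoot x).card

/-- The number of components (trees, counted by their roots) of the final forest. -/
noncomputable def trees (I : IntervalPoset) : ℕ := I.rootsUpTo I.size

open Classical in
/-- The number of children of the vertex `k` in the final forest. -/
noncomputable def childCount (I : IntervalPoset) (k : ℕ) : ℕ :=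
  ((Finset.Icc 1 I.size).filter fun j => I.IsChild j k).card

open Classical in
/-- The initial rise: the number of initial vertices `1, 2, …, k` such that there is no relation
`j - 1 ⊲ j` with `j ≤ k`. -/
noncomputable def ir (I : IntervalPoset) : ℕ :=
  ((Finset.Icc 1 I.size).filter fun k => ∀ j, j < k → ¬ I.le j (j + 1)).card

/-- The empty interval-poset. -/
def empty : IntervalPoset where
  size := 0
  le _ _ := False
  mem_of_le _ _ h := h.elim
  refl a h h' := by omega
  antisymm _ _ h := h.elim
  trans _ _ _ h := h.elim
  increasing _ _ _ _ _ h := h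
  decreasing _ _ _ _ _ h := h

/-- The subposet of `I` formed by the vertices `j` with `s < j ≤ t`, relabelled `1, 2, …`. -/
def restrict (I : IntervalPoset) (s t : ℕ) : IntervalPoset where
  size := min t I.size - s
  le a b := 1 ≤ a ∧ a ≤ min t I.size - s ∧ 1 ≤ b ∧ b ≤ min t I.size - s ∧ I.le (a + s) (b + s)
  mem_of_le a b h := ⟨⟨h.1, h.2.1⟩, h.2.2.1, h.2.2.2.1⟩
  refl a h h' := ⟨h, h', h, h', I.refl _ (by omega) (by omega)⟩
  antisymm a b h h' := by
    have := I.antisymm _ _ h.2.2.2.2 h'.2.2.2.2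
    omega
  trans a b c h h' :=
    ⟨h.1, h.2.1, h'.2.2.1, h'.2.2.2.1, I.trans _ _ _ h.2.2.2.2 h'.2.2.2.2⟩
  increasing a b c hab hbc h := by
    obtain ⟨h1, h2, h3, h4, h5⟩ := h
    exact ⟨by omega, by omega, h3, h4, I.increasing (a + s) _ _ (by omega) (by omega) h5⟩
  decreasing a b c hab hbc h := by
    obtain ⟨h1, h2, h3, h4, h5⟩ := h
    exact ⟨by omega, by omega, h3, h4, I.decreasing _ _ (c + s) (by omega) (by omega) h5⟩

/-! ### The lower contacts composition and decomposition -/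

/-- `x` is below one of the first `r` roots `x₁ < x₂ < ⋯` of the final forest of `I`. -/
def BelowFirstRoots (I : IntervalPoset) (r x : ℕ) : Prop :=
  ∃ w, I.IsRoot w ∧ I.rootsUpTo w ≤ r ∧ I.le x w

theorem BelowFirstRoots.mono {I : IntervalPoset} {r x y : ℕ} (h : I.le x y)
    (hy : I.BelowFirstRoots r y) : I.BelowFirstRoots r x := by
  obtain ⟨w, h1, h2, h3⟩ := hy
  exact ⟨w, h1, h2, I.trans _ _ _ h h3⟩

theorem exists_root_le (I : IntervalPoset) (x : ℕ) (h1 : 1 ≤ x) (h2 : x ≤ I.size) :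
    ∃ w, w ≤ x ∧ I.IsRoot w ∧ I.le x w := by
  classical
  have hex : ∃ w, I.le x w := ⟨x, I.refl x h1 h2⟩
  have hle : Nat.find hex ≤ x := Nat.find_min' hex (I.refl x h1 h2)
  have hs := Nat.find_spec hex
  have hm := I.mem_of_le _ _ hs
  exact ⟨_, hle, ⟨hm.2.1, hm.2.2, fun a ha h => Nat.find_min hex ha (I.trans _ _ _ hs h)⟩, hs⟩

theorem rootsUpTo_mono (I : IntervalPoset) {v w : ℕ} (h : v ≤ w) :
    I.rootsUpTo v ≤ I.rootsUpTo w := by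
  classical
  exact Finset.card_le_card (Finset.filter_subset_filter _ (Finset.Icc_subset_Icc_right h))

theorem BelowFirstRoots.anti {I : IntervalPoset} {r x y : ℕ} (h0 : 1 ≤ x) (h : x < y)
    (hy : I.BelowFirstRoots r y) : I.BelowFirstRoots r x := by
  obtain ⟨w, h1, h2, h3⟩ := hy
  have hm := I.mem_of_le _ _ h3
  rcases lt_trichotomy w x with hw | hw | hw
  · exact ⟨w, h1, h2, I.decreasing _ _ _ hw h h3⟩
  · subst hw
    exact ⟨w, h1, h2, I.refl _ h0 (by omega)⟩
  · obtain ⟨v, hv, hv1, hv2⟩ := I.exists_root_le x h0 (by omega)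
    exact ⟨v, hv1, (I.rootsUpTo_mono (by omega)).trans h2, hv2⟩

/-- The relations of the lower contacts composition. Put `k = I₁.size + 1`. The labels below `k`
carry `I₁`, the labels above `k` carry `I₂` (shifted by `k`), and the relations `y ⊲ k` for `y`
in `I₁` and `xᵢ ⊲ k` for the first `r` roots `xᵢ` of the final forest of `I₂` are added, together
with those that follow by transitivity. -/
def lcLe (I₁ I₂ : IntervalPoset) (r x y : ℕ) : Prop :=
  (x < I₁.size + 1 ∧ y < I₁.size + 1 ∧ I₁.le x y) ∨
  (I₁.size + 1 < x ∧ I₁.size + 1 < y ∧ I₂.le (x - (I₁.size + 1)) (y - (I₁.size + 1))) ∨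
  (1 ≤ x ∧ x ≤ I₁.size + 1 ∧ y = I₁.size + 1) ∨
  (I₁.size + 1 < x ∧ y = I₁.size + 1 ∧ I₂.BelowFirstRoots r (x - (I₁.size + 1)))

theorem BelowFirstRoots.mem {I : IntervalPoset} {r x : ℕ} (h : I.BelowFirstRoots r x) :
    1 ≤ x ∧ x ≤ I.size := by
  obtain ⟨w, h1, h2, h3⟩ := h
  exact (I.mem_of_le _ _ h3).1

/-- The lower contacts composition `LC(I₁, I₂, r)`, for `0 ≤ r ≤ trees(I₂)`. -/
def LC (I₁ I₂ : IntervalPoset) (r : ℕ) : IntervalPoset where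
  size := I₁.size + 1 + I₂.size
  le := lcLe I₁ I₂ r
  mem_of_le a b h := by
    rcases h with ⟨h1, h2, h3⟩ | ⟨h1, h2, h3⟩ | ⟨h1, h2, h3⟩ | ⟨h1, h2, h3⟩
    · have := I₁.mem_of_le _ _ h3; omega
    · have := I₂.mem_of_le _ _ h3; omega
    · omega
    · have := h3.mem; omega
  refl a h h' := by
    rcases lt_trichotomy a (I₁.size + 1) with ha | ha | ha
    · exact Or.inl ⟨ha, ha, I₁.refl _ h (by omega)⟩
    · exact Or.inr (Or.inr (Or.inl ⟨h, by omega, ha⟩))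
    · exact Or.inr (Or.inl ⟨ha, ha, I₂.refl _ (by omega) (by omega)⟩)
  antisymm a b h h' := by
    rcases h with ⟨h1, h2, h3⟩ | ⟨h1, h2, h3⟩ | ⟨h1, h2, h3⟩ | ⟨h1, h2, h3⟩ <;>
    rcases h' with ⟨h1', h2', h3'⟩ | ⟨h1', h2', h3'⟩ | ⟨h1', h2', h3'⟩ | ⟨h1', h2', h3'⟩ <;>
    first
      | omega
      | exact I₁.antisymm _ _ h3 h3'
      | (have := I₂.antisymm _ _ h3 h3'; omega)
  trans a b c h h' := by
    rcases h with ⟨h1, h2, h3⟩ | ⟨h1, h2, h3⟩ | ⟨h1, h2, h3⟩ | ⟨h1, h2, h3⟩ <;>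
    rcases h' with ⟨h1', h2', h3'⟩ | ⟨h1', h2', h3'⟩ | ⟨h1', h2', h3'⟩ | ⟨h1', h2', h3'⟩ <;>
    first
      | omega
      | exact Or.inl ⟨h1, h2', I₁.trans _ _ _ h3 h3'⟩
      | exact Or.inr (Or.inl ⟨h1, h2', I₂.trans _ _ _ h3 h3'⟩)
      | exact Or.inr (Or.inr (Or.inl ⟨(I₁.mem_of_le _ _ h3).1.1, by omega, h3'⟩))
      | exact Or.inr (Or.inr (Or.inl ⟨h1, by omega, h3'⟩))
      | exact Or.inr (Or.inr (Or.inr ⟨h1, h2', h3'.mono h3⟩))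
      | exact Or.inr (Or.inr (Or.inr ⟨h1, by omega, h3⟩))
  increasing a b c hab hbc h := by
    rcases h with ⟨h1, h2, h3⟩ | ⟨h1, h2, h3⟩ | ⟨h1, h2, h3⟩ | ⟨h1, h2, h3⟩
    · exact Or.inl ⟨by omega, h2, I₁.increasing _ _ _ hab hbc h3⟩
    · exact Or.inr (Or.inl ⟨by omega, h2,
        I₂.increasing _ _ _ (by omega : a - (I₁.size + 1) < b - (I₁.size + 1)) (by omega) h3⟩)
    · exact Or.inr (Or.inr (Or.inl ⟨by omega, by omega, h3⟩))
    · omega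
  decreasing a b c hab hbc h := by
    rcases h with ⟨h1, h2, h3⟩ | ⟨h1, h2, h3⟩ | ⟨h1, h2, h3⟩ | ⟨h1, h2, h3⟩
    · exact Or.inl ⟨by omega, h2, I₁.decreasing _ _ _ hab hbc h3⟩
    · exact Or.inr (Or.inl ⟨by omega, h2,
        I₂.decreasing _ _ _ (by omega) (by omega : b - (I₁.size + 1) < c - (I₁.size + 1)) h3⟩)
    · omega
    · exact Or.inr (Or.inr (Or.inr ⟨by omega, h2, h3.anti (by omega) (by omega)⟩))

/-- All vertices smaller than `k` are below `k`. -/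
def IsAboveSmaller (I : IntervalPoset) (k : ℕ) : Prop := ∀ i, 1 ≤ i → i < k → I.le i k

open Classical in
/-- The root of `I` for the lower contacts decomposition: the maximal label `k` such that `i ⊲ k`
for all `i < k`. -/
noncomputable def lcRoot (I : IntervalPoset) : ℕ := Nat.findGreatest I.IsAboveSmaller I.size

theorem lcRoot_le (I : IntervalPoset) : I.lcRoot ≤ I.size := by
  classical
  exact Nat.findGreatest_le _

theorem one_le_lcRoot (I : IntervalPoset) (h : I.size ≠ 0) : 1 ≤ I.lcRoot := by
  classical
  exact Nat.le_findGreatest (by omega) (fun i h1 h2 => by omega)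

/-- The first component of the lower contacts decomposition: the vertices smaller than the root. -/
noncomputable def lcLeft (I : IntervalPoset) : IntervalPoset := I.restrict 0 (I.lcRoot - 1)

/-- The second component of the lower contacts decomposition: the vertices larger than the root. -/
noncomputable def lcRight (I : IntervalPoset) : IntervalPoset := I.restrict I.lcRoot I.size

/-- The third component of the lower contacts decomposition: the number of children of the root in
the final forest. -/
noncomputable def lcNum (I : IntervalPoset) : ℕ := I.childCount I.lcRoot

/-! ### The initial rise composition -/

theorem mem_ir_iff (I : IntervalPoset) {k : ℕ} (h1 : 1 ≤ k) (h2 : k ≤ I.size) :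
    (∀ j, j < k → ¬ I.le j (j + 1)) ↔ k ≤ I.ir := by
  classical
  unfold ir
  constructor
  · intro h
    calc k = (Finset.Icc 1 k).card := by simp
      _ ≤ _ := by
        apply Finset.card_le_card
        intro i hi
        rw [Finset.mem_Icc] at hi
        simp only [Finset.mem_filter, Finset.mem_Icc]
        exact ⟨by omega, fun j hj => h j (by omega)⟩
  · intro h
    by_contra hn
    have : ((Finset.Icc 1 I.size).filter fun k => ∀ j, j < k → ¬ I.le j (j + 1)).card ≤
        (Finset.Icc 1 (k - 1)).card := by
      apply Finset.card_le_card
      intro i hi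
      simp only [Finset.mem_filter, Finset.mem_Icc] at hi
      rw [Finset.mem_Icc]
      by_contra hi'
      exact hn fun j hj => hi.2 j (by omega)
    rw [Nat.card_Icc] at this
    omega

theorem ir_le (I : IntervalPoset) : I.ir ≤ I.size := by
  classical
  unfold ir
  exact (Finset.card_filter_le _ _).trans (by simp)

theorem ir_pos (I : IntervalPoset) (h : I.size ≠ 0) : 1 ≤ I.ir := by
  refine (I.mem_ir_iff le_rfl (by omega)).1 fun j hj h' => ?_
  have := I.mem_of_le _ _ h'
  omega

theorem le_ir_succ (I : IntervalPoset) (h : I.ir < I.size) : I.le I.ir (I.ir + 1) := by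
  by_contra hn
  have h1 := (I.mem_ir_iff (I.ir_pos (by omega)) h.le).2 le_rfl
  have := (I.mem_ir_iff (k := I.ir + 1) (by omega) h).1 (by
    intro j hj
    rcases Nat.eq_or_lt_of_le (Nat.le_of_lt_succ hj) with h | h
    · exact h ▸ hn
    · exact h1 j h)
  omega

theorem IsChild.unique {I : IntervalPoset} {j k l : ℕ} (hk : I.IsChild j k) (hl : I.IsChild j l) :
    k = l := by
  rcases lt_trichotomy k l with h | h | h
  · exact absurd ⟨hl.2.1, I.decreasing _ _ _ h hl.1 hk.2.1⟩ (hk.2.2 l h hl.1)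
  · exact h
  · exact absurd ⟨hk.2.1, I.decreasing _ _ _ h hk.1 hl.2.1⟩ (hl.2.2 k h hk.1)

theorem sum_childCount_le (I : IntervalPoset) (y e : ℕ)
    (he : ∀ j k, y ≤ k → k ≤ e → I.IsChild j k → j ≤ e) :
    ∑ k ∈ Finset.Icc y e, I.childCount k ≤ e - y := by
  classical
  unfold childCount
  rw [← Finset.card_biUnion]
  · rw [← Nat.card_Ioc]
    apply Finset.card_le_card
    intro j hj
    simp only [Finset.mem_biUnion, Finset.mem_filter, Finset.mem_Icc] at hj
    obtain ⟨k, hk, _, hc⟩ := hj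
    have := hc.1
    have := he j k hk.1 hk.2 hc
    simp only [Finset.mem_Ioc]
    omega
  · intro k _ l _ hkl
    rw [Function.onFun, Finset.disjoint_left]
    intro j hj hj'
    simp only [Finset.mem_filter] at hj hj'
    exact hkl (hj.2.unique hj'.2)

/-- In a final forest, a vertex `x > y` that satisfies the counting condition is below `y`. -/
theorem le_of_lt_sum (I : IntervalPoset) {x y : ℕ} (hy : 1 ≤ y) (hyx : y < x) (hx : x ≤ I.size)
    (h : ∀ m, y ≤ m → m < x → m < y + ∑ i ∈ Finset.Icc y m, I.childCount i) : I.le x y := by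
  classical
  by_contra hxy
  set e := Nat.findGreatest (fun z => I.le z y) x with he
  have hey : I.le e y := Nat.findGreatest_spec (P := fun z => I.le z y) hyx.le
    (I.refl y hy (by omega))
  have hye : y ≤ e := Nat.le_findGreatest hyx.le (I.refl y hy (by omega))
  have hex : e ≤ x := Nat.findGreatest_le _
  have hex' : e ≠ x := fun h => hxy (h ▸ hey)
  have hsum := h e hye (by omega)
  have := I.sum_childCount_le y e (by
    intro j k hyk hke hc
    have hky : I.le k y := by
      rcases Nat.eq_or_lt_of_le hyk with h | h
      · exact h ▸ I.refl y hy (by omega)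
      · rcases Nat.eq_or_lt_of_le hke with h' | h'
        · exact h' ▸ hey
        · exact I.decreasing _ _ _ h h' hey
    have hjy : I.le j y := I.trans _ _ _ hc.2.1 hky
    rcases lt_trichotomy j x with hj | hj | hj
    · exact Nat.le_findGreatest hj.le hjy
    · exact absurd (hj ▸ hjy) hxy
    · exact absurd (I.decreasing _ _ _ hyx hj hjy) hxy)
  omega

/-- Relabelling after the insertion of a vertex `k`: a former vertex with new label `x ≠ k` had the
label `old k x`. (For `x = k` the value is `k`, the former label of the vertex `k + 1`.) -/
def old (k x : ℕ) : ℕ := if x ≤ k then x else x - 1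

/-- The prescribed numbers of children after the insertion of a vertex `k` in `I`: every former
vertex keeps its number of children, and the vertex `k` has none. -/
noncomputable def insertCount (I : IntervalPoset) (k i : ℕ) : ℕ :=
  if i = k then 0 else I.childCount (old k i)

theorem sum_insertCount_of_lt (I : IntervalPoset) {k y m : ℕ} (h : m < k) :
    ∑ i ∈ Finset.Icc y m, I.insertCount k i = ∑ i ∈ Finset.Icc y m, I.childCount i := by
  apply Finset.sum_congr rfl
  intro i hi
  rw [Finset.mem_Icc] at hi
  rw [insertCount, old, if_neg (by omega), if_pos (by omega)]

theorem sum_insertCount_of_gt (I : IntervalPoset) {k y m : ℕ} (h : k < y) :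
    ∑ i ∈ Finset.Icc y (m + 1), I.insertCount k i =
      ∑ i ∈ Finset.Icc (y - 1) m, I.childCount i := by
  obtain ⟨z, rfl⟩ : ∃ z, y = z + 1 := ⟨y - 1, by omega⟩
  rw [Nat.add_sub_cancel, ← Finset.map_add_right_Icc z m 1, Finset.sum_map]
  apply Finset.sum_congr rfl
  intro i hi
  rw [Finset.mem_Icc] at hi
  simp only [addRightEmbedding_apply]
  rw [insertCount, old, if_neg (by omega), if_neg (by omega), Nat.add_sub_cancel]

theorem sum_insertCount_of_mem (I : IntervalPoset) {k y m : ℕ} (h : y ≤ k) (h' : k ≤ m + 1) :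
    ∑ i ∈ Finset.Icc y (m + 1), I.insertCount k i =
      ∑ i ∈ Finset.Icc y m, I.childCount i := by
  induction m with
  | zero =>
    rcases Nat.eq_or_lt_of_le h' with h1 | h1
    · rw [Finset.sum_Icc_succ_top (by omega), I.sum_insertCount_of_lt (by omega), insertCount,
        if_pos h1.symm, add_zero]
    · obtain rfl : k = 0 := by omega
      obtain rfl : y = 0 := by omega
      simp [Finset.sum_Icc_succ_top, insertCount, old]
  | succ m ih =>
    rcases Nat.eq_or_lt_of_le h' with h1 | h1
    · rw [Finset.sum_Icc_succ_top (by omega), I.sum_insertCount_of_lt (by omega), insertCount,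
        if_pos h1.symm, add_zero]
    · rw [Finset.sum_Icc_succ_top (by omega), ih (by omega), Finset.sum_Icc_succ_top (by omega),
        insertCount, old, if_neg (by omega), if_neg (by omega), Nat.add_sub_cancel]

/-- The relations after the insertion of a vertex `k ≤ ir(I) + 1` in `I`.

Increasing relations: those of `I`, together with `k ⊲ k + 1` (if `k + 1` is a label) and what
follows by transitivity.

Decreasing relations: those of the unique final forest with the prescribed numbers of children
`insertCount I k`. The labels of a final forest follow its prefix order, so the vertex `x > y` is a
descendant of `y` exactly when the vertices `y, …, m` have together at least `m - y + 1` children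
for all `y ≤ m < x`; see `childCount_insertVertex`. -/
def insertLe (I : IntervalPoset) (k x y : ℕ) : Prop :=
  1 ≤ x ∧ x ≤ I.size + 1 ∧ 1 ≤ y ∧ y ≤ I.size + 1 ∧
    (x = y ∨
      (x < y ∧ y ≠ k ∧ I.le (old k x) (old k y)) ∨
      (y < x ∧ ∀ m, y ≤ m → m < x → m < y + ∑ i ∈ Finset.Icc y m, I.insertCount k i))

theorem insertLe_compat (I : IntervalPoset) {k x y : ℕ} (hk1 : 1 ≤ k) (hk2 : k ≤ I.size + 1)
    (h1 : 1 ≤ y) (hxy : y < x)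
    (hx : x ≤ I.size + 1) (hk : x ≠ k)
    (h : ∀ m, y ≤ m → m < x → m < y + ∑ i ∈ Finset.Icc y m, I.insertCount k i) :
    I.le (old k x) (old k y) ∧ old k y < old k x := by
  have hyk : y ≠ k := by
    rintro rfl
    have := h y le_rfl hxy
    simp [insertCount] at this
  have hlt : old k y < old k x := by unfold old; split_ifs <;> omega
  refine ⟨?_, hlt⟩
  apply I.le_of_lt_sum
  · unfold old; split_ifs <;> omega
  · exact hlt
  · unfold old; split_ifs <;> omega
  · intro m hm1 hm2
    by_cases hyk' : y < k
    · have e : old k y = y := if_pos hyk'.le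
      rw [e] at hm1 ⊢
      by_cases hmk : m < k
      · rw [← I.sum_insertCount_of_lt hmk]
        refine h m hm1 ?_
        unfold old at hm2; split_ifs at hm2 <;> omega
      · rw [← I.sum_insertCount_of_mem hyk'.le (by omega)]
        have := h (m + 1) (by omega) (by unfold old at hm2; split_ifs at hm2 <;> omega)
        omega
    · have e : old k y = y - 1 := if_neg (by omega)
      rw [e] at hm1 ⊢
      rw [← I.sum_insertCount_of_gt (show k < y by omega)]
      have := h (m + 1) (by omega) (by unfold old at hm2; split_ifs at hm2 <;> omega)
      omega

/-- The label `ir(I) - r + 1` of the vertex inserted in `I` for the initial rise composition. -/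
noncomputable def insertPos (I : IntervalPoset) (r : ℕ) : ℕ := I.ir - r + 1

theorem one_le_insertPos (I : IntervalPoset) (r : ℕ) : 1 ≤ I.insertPos r := Nat.le_add_left _ _

theorem insertPos_le (I : IntervalPoset) (r : ℕ) : I.insertPos r ≤ I.size + 1 := by
  have := I.ir_le
  unfold insertPos
  omega

theorem insertLe_inc (I : IntervalPoset) {k a b c : ℕ} (hab : a < b) (hbc : b < c)
    (h : I.le (old k a) (old k c)) : I.le (old k b) (old k c) := by
  have hm := I.mem_of_le _ _ h
  have h1 : old k a = old k b ∨ old k a < old k b := by unfold old; split_ifs <;> omega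
  have h2 : old k b = old k c ∨ old k b < old k c := by unfold old; split_ifs <;> omega
  rcases h1 with h1 | h1
  · exact h1 ▸ h
  · rcases h2 with h2 | h2
    · rw [h2]; exact I.refl _ hm.2.1 hm.2.2
    · exact I.increasing _ _ _ h1 h2 h

theorem insertLe_false (I : IntervalPoset) {k x y : ℕ} (hk1 : 1 ≤ k) (hk2 : k ≤ I.size + 1)
    (h1 : 1 ≤ y) (hxy : y < x)
    (hx : x ≤ I.size + 1) (hk : x ≠ k)
    (h : ∀ m, y ≤ m → m < x → m < y + ∑ i ∈ Finset.Icc y m, I.insertCount k i)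
    (h' : I.le (old k y) (old k x)) : False := by
  have := I.insertLe_compat hk1 hk2 h1 hxy hx hk h
  have := I.antisymm _ _ h' this.1
  omega

/-- The insertion of the new vertex `ir(I) - r + 1` in `I`, for `0 ≤ r ≤ ir(I)`. -/
noncomputable def insertVertex (I : IntervalPoset) (r : ℕ) : IntervalPoset where
  size := I.size + 1
  le := I.insertLe (I.insertPos r)
  mem_of_le a b h := ⟨⟨h.1, h.2.1⟩, h.2.2.1, h.2.2.2.1⟩
  refl a h h' := ⟨h, h', h, h', Or.inl rfl⟩
  antisymm a b h h' := by
    obtain ⟨h1, h2, h3, h4, h5⟩ := h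
    obtain ⟨-, -, -, -, h5'⟩ := h'
    rcases h5 with h5 | h5 | h5
    · exact h5
    · rcases h5' with h5' | h5' | h5'
      · exact h5'.symm
      · omega
      · have := I.insertLe_compat (I.one_le_insertPos r) (I.insertPos_le r) h1 h5'.1 h4 h5.2.1 h5'.2
        have := I.antisymm _ _ h5.2.2 this.1
        omega
    · rcases h5' with h5' | h5' | h5'
      · exact h5'.symm
      · have := I.insertLe_compat (I.one_le_insertPos r) (I.insertPos_le r) h3 h5.1 h2 h5'.2.1 h5.2
        have := I.antisymm _ _ h5'.2.2 this.1
        omega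
      · omega
  trans a b c h h' := by
    obtain ⟨h1, h2, h3, h4, h5⟩ := h
    obtain ⟨-, -, h3', h4', h5'⟩ := h'
    refine ⟨h1, h2, h3', h4', ?_⟩
    rcases h5 with rfl | h5 | h5
    · exact h5'
    · rcases h5' with rfl | h5' | h5'
      · exact Or.inr (Or.inl h5)
      · exact Or.inr (Or.inl ⟨by omega, h5'.2.1, I.trans _ _ _ h5.2.2 h5'.2.2⟩)
      · rcases lt_trichotomy a c with hac | hac | hac
        · exact (I.insertLe_false (I.one_le_insertPos r) (I.insertPos_le r) h3' h5'.1 h4 h5.2.1 h5'.2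
            (I.insertLe_inc hac h5'.1 h5.2.2)).elim
        · exact Or.inl hac
        · exact Or.inr (Or.inr ⟨hac, fun m hm hm' => h5'.2 m hm (by omega)⟩)
    · rcases h5' with rfl | h5' | h5'
      · exact Or.inr (Or.inr h5)
      · rcases lt_trichotomy a c with hac | hac | hac
        · exact Or.inr (Or.inl ⟨hac, h5'.2.1, I.insertLe_inc h5.1 hac h5'.2.2⟩)
        · exact Or.inl hac
        · exact (I.insertLe_false (I.one_le_insertPos r) (I.insertPos_le r) h3 h5'.1 h4' h5'.2.1
            (fun m hm hm' => h5.2 m hm (by omega)) h5'.2.2).elim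
      · refine Or.inr (Or.inr ⟨by omega, fun m hm hm' => ?_⟩)
        by_cases hmb : m < b
        · exact h5'.2 m hm hmb
        · have e1 := h5.2 m (by omega) hm'
          have e2 := h5'.2 (b - 1) (by omega) (by omega)
          have e3 : ∑ i ∈ Finset.Icc c m, I.insertCount (I.insertPos r) i =
              ∑ i ∈ Finset.Icc c (b - 1), I.insertCount (I.insertPos r) i +
                ∑ i ∈ Finset.Icc b m, I.insertCount (I.insertPos r) i := by
            rw [← Finset.sum_union]
            · congr 1
              ext i
              simp only [Finset.mem_union, Finset.mem_Icc]
              omega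
            · rw [Finset.disjoint_left]
              intro i
              simp only [Finset.mem_Icc]
              omega
          omega
  increasing a b c hab hbc h := by
    obtain ⟨h1, h2, h3, h4, h5⟩ := h
    refine ⟨by omega, by omega, h3, h4, ?_⟩
    rcases h5 with h5 | h5 | h5
    · omega
    · exact Or.inr (Or.inl ⟨hbc, h5.2.1, I.insertLe_inc hab hbc h5.2.2⟩)
    · omega
  decreasing a b c hab hbc h := by
    obtain ⟨h1, h2, h3, h4, h5⟩ := h
    refine ⟨by omega, by omega, h3, h4, ?_⟩
    rcases h5 with h5 | h5 | h5
    · omega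
    · omega
    · exact Or.inr (Or.inr ⟨hab, fun m hm hm' => h5.2 m hm (by omega)⟩)

theorem sum_childCount_eq (I : IntervalPoset) (y e : ℕ)
    (he : ∀ j k, y ≤ k → k ≤ e → I.IsChild j k → j ≤ e)
    (hle : ∀ j, y < j → j ≤ e → I.le j y) :
    ∑ k ∈ Finset.Icc y e, I.childCount k = e - y := by
  classical
  apply le_antisymm (I.sum_childCount_le y e he)
  unfold childCount
  rw [← Nat.card_Ioc]
  refine le_trans (Finset.card_le_card ?_) Finset.card_biUnion_le
  intro j hj
  rw [Finset.mem_Ioc] at hj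
  have hjy := hle j hj.1 hj.2
  have hm := I.mem_of_le _ _ hjy
  set k := Nat.findGreatest (fun z => I.le j z) (j - 1) with hk
  have h1 : I.le j k := Nat.findGreatest_spec (P := fun z => I.le j z) (m := y) (by omega) hjy
  have h2 : y ≤ k := Nat.le_findGreatest (by omega) hjy
  have h3 : k ≤ j - 1 := Nat.findGreatest_le _
  simp only [Finset.mem_biUnion, Finset.mem_filter, Finset.mem_Icc]
  refine ⟨k, by omega, hm.1, by omega, h1, fun i hi hi' h => ?_⟩
  exact Nat.findGreatest_is_greatest (P := fun z => I.le j z) hi (by omega) h.1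

theorem sum_insertCount_le (I : IntervalPoset) {k y : ℕ} (hk1 : 1 ≤ k) (hk2 : k ≤ I.size + 1)
    (h1 : 1 ≤ y) (h2 : y ≤ I.size + 1) :
    ∑ i ∈ Finset.Icc y (I.size + 1), I.insertCount k i ≤ I.size + 1 - y := by
  have key : ∀ z, ∑ i ∈ Finset.Icc z I.size, I.childCount i ≤ I.size - z := fun z =>
    I.sum_childCount_le z I.size fun j k _ _ h => (I.mem_of_le _ _ h.2.1).1.2
  by_cases hyk : y ≤ k
  · rw [I.sum_insertCount_of_mem hyk hk2]
    have := key y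
    omega
  · rw [I.sum_insertCount_of_gt (by omega)]
    have := key (y - 1)
    omega

/-- The vertices of `insertVertex I r` have the prescribed numbers of children. -/
theorem childCount_insertVertex (I : IntervalPoset) (r : ℕ) {y : ℕ} (h1 : 1 ≤ y)
    (h2 : y ≤ I.size + 1) :
    (I.insertVertex r).childCount y = I.insertCount (I.insertPos r) y := by
  classical
  have hk1 := I.one_le_insertPos r
  have hk2 := I.insertPos_le r
  induction hn : I.size + 1 - y using Nat.strong_induction_on generalizing y with
  | _ n ih =>
    have hex : ∃ m, y ≤ m ∧ ¬ m < y + ∑ i ∈ Finset.Icc y m, I.insertCount (I.insertPos r) i :=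
      ⟨I.size + 1, h2, by have := I.sum_insertCount_le hk1 hk2 h1 h2; omega⟩
    have hN : Nat.find hex ≤ I.size + 1 := Nat.find_min' hex
      ⟨h2, by have := I.sum_insertCount_le hk1 hk2 h1 h2; omega⟩
    have hs := Nat.find_spec hex
    have hmin : ∀ m, m < Nat.find hex → y ≤ m →
        m < y + ∑ i ∈ Finset.Icc y m, I.insertCount (I.insertPos r) i := by
      intro m hm hym
      by_contra hc
      exact Nat.find_min hex hm ⟨hym, hc⟩
    generalize Nat.find hex = e at hN hs hmin
    obtain ⟨hye, hs⟩ := hs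
    have hle : ∀ x, y < x → (x ≤ e ↔ (I.insertVertex r).le x y) := by
      intro x hx
      constructor
      · intro hxe
        exact ⟨by omega, by omega, h1, h2,
          Or.inr (Or.inr ⟨hx, fun m hm hm' => hmin m (by omega) hm⟩)⟩
      · rintro ⟨-, -, -, -, h | h | h⟩
        · omega
        · omega
        · by_contra hxe
          exact hs (h.2 e hye (by omega))
    have hsum : ∑ i ∈ Finset.Icc y e, I.insertCount (I.insertPos r) i = e - y := by
      rcases Nat.eq_or_lt_of_le hye with h | h
      · omega
      · have a1 := hmin (e - 1) (by omega) (by omega)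
        have a2 : ∑ i ∈ Finset.Icc y (e - 1), I.insertCount (I.insertPos r) i ≤
            ∑ i ∈ Finset.Icc y e, I.insertCount (I.insertPos r) i :=
          Finset.sum_le_sum_of_subset (Finset.Icc_subset_Icc_right (by omega))
        omega
    have hsum' := (I.insertVertex r).sum_childCount_eq y e (by
      intro j k hyk hke hc
      have hjk := hc.1
      apply (hle j (by omega)).2
      rcases Nat.eq_or_lt_of_le hyk with h | h
      · exact h ▸ hc.2.1
      · exact (I.insertVertex r).trans _ _ _ hc.2.1 ((hle k h).1 hke))
      (fun j hj hje => (hle j hj).1 hje)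
    rw [← Finset.add_sum_Ioc_eq_sum_Icc hye] at hsum hsum'
    have hcongr : ∑ i ∈ Finset.Ioc y e, (I.insertVertex r).childCount i =
        ∑ i ∈ Finset.Ioc y e, I.insertCount (I.insertPos r) i := by
      apply Finset.sum_congr rfl
      intro i hi
      rw [Finset.mem_Ioc] at hi
      exact ih (I.size + 1 - i) (by omega) (by omega) (by omega) rfl
    omega

/-- `x` is one of the `m` labels inserted right after the label `a`. -/
def Inserted (a m x : ℕ) : Prop := a < x ∧ x ≤ a + m

/-- Relabelling after the insertion of `m` labels right after `a`: a vertex that is not one of the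
inserted ones and has the new label `x` had the label `oldMerge a m x`. -/
def oldMerge (a m x : ℕ) : ℕ := if x ≤ a then x else x - m

/-- The relations of the poset obtained by merging `I` and `J`. Put `a = ir(I)`. The vertices of
`J` are inserted right after `a`; the relations `j ⊲ a` for `j` in `J` (if `a` is a vertex of `I`,
that is, if `I` is not empty) and, if `a ≠ I.size`, the relations `j ⊲ b` for `j` in `J` and
`b = a + 1 + J.size` are added, together with those that follow by transitivity. As `a ⊲ a + 1`
in `I` when `a ≠ I.size`, a vertex of `J` is thus below the vertices of `I` that `a` is below or
equal to. -/
def mergeLe (I J : IntervalPoset) (x y : ℕ) : Prop :=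
  (¬ Inserted I.ir J.size x ∧ ¬ Inserted I.ir J.size y ∧
    I.le (oldMerge I.ir J.size x) (oldMerge I.ir J.size y)) ∨
  (Inserted I.ir J.size x ∧ Inserted I.ir J.size y ∧ J.le (x - I.ir) (y - I.ir)) ∨
  (Inserted I.ir J.size x ∧ ¬ Inserted I.ir J.size y ∧
    I.le I.ir (oldMerge I.ir J.size y))

/-- The result of merging `I` and `J`, by inserting the vertices of `J` right after the vertex
`ir(I)` of `I`. -/
noncomputable def merge (I J : IntervalPoset) : IntervalPoset where
  size := I.size + J.size
  le := mergeLe I J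
  mem_of_le a b h := by
    have := I.ir_le
    unfold mergeLe Inserted oldMerge at h
    rcases h with ⟨h1, h2, h3⟩ | ⟨h1, h2, h3⟩ | ⟨h1, h2, h3⟩
    · have := I.mem_of_le _ _ h3
      split_ifs at this <;> omega
    · omega
    · have := I.mem_of_le _ _ h3
      split_ifs at this <;> omega
  refl a h h' := by
    by_cases ha : Inserted I.ir J.size a
    · refine Or.inr (Or.inl ⟨ha, ha, J.refl _ ?_ ?_⟩) <;> (unfold Inserted at ha; omega)
    · refine Or.inl ⟨ha, ha, I.refl _ ?_ ?_⟩ <;>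
      (have := I.ir_le; unfold Inserted at ha; unfold oldMerge; split_ifs <;> omega)
  antisymm a b h h' := by
    rcases h with ⟨h1, h2, h3⟩ | ⟨h1, h2, h3⟩ | ⟨h1, h2, h3⟩ <;>
    rcases h' with ⟨h1', h2', h3'⟩ | ⟨h1', h2', h3'⟩ | ⟨h1', h2', h3'⟩ <;>
    try contradiction
    · have := I.antisymm _ _ h3 h3'
      unfold Inserted at h1 h2
      unfold oldMerge at this
      split_ifs at this <;> omega
    · have := J.antisymm _ _ h3 h3'
      unfold Inserted at h1 h2
      omega
  trans a b c h h' := by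
    rcases h with ⟨h1, h2, h3⟩ | ⟨h1, h2, h3⟩ | ⟨h1, h2, h3⟩ <;>
    rcases h' with ⟨h1', h2', h3'⟩ | ⟨h1', h2', h3'⟩ | ⟨h1', h2', h3'⟩ <;>
    try contradiction
    · exact Or.inl ⟨h1, h2', I.trans _ _ _ h3 h3'⟩
    · exact Or.inr (Or.inl ⟨h1, h2', J.trans _ _ _ h3 h3'⟩)
    · exact Or.inr (Or.inr ⟨h1, h2', h3'⟩)
    · exact Or.inr (Or.inr ⟨h1, h2', I.trans _ _ _ h3 h3'⟩)
  increasing a b c hab hbc h := by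
    have hir := I.ir_le
    rcases h with ⟨h1, h2, h3⟩ | ⟨h1, h2, h3⟩ | ⟨h1, h2, h3⟩
    · have hm := I.mem_of_le _ _ h3
      by_cases hb : Inserted I.ir J.size b
      · refine Or.inr (Or.inr ⟨hb, h2, ?_⟩)
        have e1 : oldMerge I.ir J.size a = a := by
          unfold Inserted at *; unfold oldMerge; split_ifs <;> omega
        have e2 : I.ir < oldMerge I.ir J.size c := by
          unfold Inserted at *; unfold oldMerge; split_ifs <;> omega
        rw [e1] at h3
        rcases Nat.eq_or_lt_of_le (show a ≤ I.ir by unfold Inserted at *; omega) with h | h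
        · exact h ▸ h3
        · exact I.increasing _ _ _ h e2 h3
      · refine Or.inl ⟨hb, h2, I.increasing _ _ _ ?_ ?_ h3⟩ <;>
        (unfold Inserted at *; unfold oldMerge; split_ifs <;> omega)
    · refine Or.inr (Or.inl ⟨?_, h2, J.increasing (a - I.ir) _ _ ?_ ?_ h3⟩) <;>
      (unfold Inserted at *; omega)
    · have hm := I.mem_of_le _ _ h3
      by_cases hb : Inserted I.ir J.size b
      · exact Or.inr (Or.inr ⟨hb, h2, h3⟩)
      · refine Or.inl ⟨hb, h2, I.increasing I.ir _ _ ?_ ?_ h3⟩ <;>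
        (unfold Inserted at *; unfold oldMerge; split_ifs <;> omega)
  decreasing a b c hab hbc h := by
    have hir := I.ir_le
    rcases h with ⟨h1, h2, h3⟩ | ⟨h1, h2, h3⟩ | ⟨h1, h2, h3⟩
    · have hm := I.mem_of_le _ _ h3
      by_cases hb : Inserted I.ir J.size b
      · refine Or.inr (Or.inr ⟨hb, h2, ?_⟩)
        have e1 : oldMerge I.ir J.size a = a := by
          unfold Inserted at *; unfold oldMerge; split_ifs <;> omega
        have e2 : I.ir < oldMerge I.ir J.size c := by
          unfold Inserted at *; unfold oldMerge; split_ifs <;> omega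
        rw [e1] at h3 hm ⊢
        rcases Nat.eq_or_lt_of_le (show a ≤ I.ir by unfold Inserted at *; omega) with h | h
        · rw [← h]
          exact I.refl _ hm.2.1 hm.2.2
        · exact I.decreasing _ _ _ h e2 h3
      · refine Or.inl ⟨hb, h2, I.decreasing _ _ _ ?_ ?_ h3⟩ <;>
        (unfold Inserted at *; unfold oldMerge; split_ifs <;> omega)
    · refine Or.inr (Or.inl ⟨?_, h2, J.decreasing _ _ (c - I.ir) ?_ ?_ h3⟩) <;>
      (unfold Inserted at *; omega)
    · have hm := I.mem_of_le _ _ h3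
      by_cases hb : Inserted I.ir J.size b
      · exact Or.inr (Or.inr ⟨hb, h2, h3⟩)
      · have e1 : oldMerge I.ir J.size b = b := by
          unfold Inserted at *; unfold oldMerge; split_ifs <;> omega
        refine Or.inl ⟨hb, h2, ?_⟩
        rw [e1]
        rcases Nat.eq_or_lt_of_le (show b ≤ I.ir by unfold Inserted at *; omega) with h | h
        · exact h ▸ h3
        · refine I.decreasing _ _ I.ir ?_ h h3
          unfold Inserted at *; unfold oldMerge; split_ifs <;> omega

/-- The initial rise composition `IR(I₁, I₂, r)`, for `0 ≤ r ≤ ir(I₂)`: the vertex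
`ir(I₂) - r + 1` is inserted in `I₂`, and the result is merged with `I₁`. -/
noncomputable def IR (I₁ I₂ : IntervalPoset) (r : ℕ) : IntervalPoset :=
  I₁.merge (I₂.insertVertex r)

/-! ### The map β -/

theorem size_lcLeft_lt (I : IntervalPoset) (h : I.size ≠ 0) : I.lcLeft.size < I.size := by
  have h1 := I.one_le_lcRoot h
  have h2 := I.lcRoot_le
  change min (I.lcRoot - 1) I.size - 0 < I.size
  omega

theorem size_lcRight_lt (I : IntervalPoset) (h : I.size ≠ 0) : I.lcRight.size < I.size := by
  have h1 := I.one_le_lcRoot h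
  have h2 := I.lcRoot_le
  change min I.size I.size - I.lcRoot < I.size
  omega

open Classical in
/-- The map `β`: it sends the empty interval-poset to itself, and an interval-poset with lower
contacts decomposition `I = LC(I₁, I₂, r)` to `IR(β(I₁), β(I₂), r)`. -/
noncomputable def β (I : IntervalPoset) : IntervalPoset :=
  if h : I.size = 0 then empty
  else
    have := I.size_lcLeft_lt h
    have := I.size_lcRight_lt h
    IR (β I.lcLeft) (β I.lcRight) I.lcNum
termination_by I.size

/-! ### The generating function -/

instance finite_size (n : ℕ) : Finite {I : IntervalPoset // I.size = n} := by
  apply Finite.of_injective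
    (fun I : {I : IntervalPoset // I.size = n} =>
      fun a b : Fin (n + 1) => I.1.le a b)
  intro I J h
  obtain ⟨I, hI⟩ := I
  obtain ⟨J, hJ⟩ := J
  apply Subtype.ext
  apply IntervalPoset.ext
  · exact hI.trans hJ.symm
  · funext a b
    by_cases hab : a < n + 1 ∧ b < n + 1
    · exact congrFun (congrFun h ⟨a, hab.1⟩) ⟨b, hab.2⟩
    · apply propext
      constructor
      · intro h'
        have := I.mem_of_le _ _ h'
        exact absurd ⟨by omega, by omega⟩ hab
      · intro h'
        have := J.mem_of_le _ _ h'
        exact absurd ⟨by omega, by omega⟩ hab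

noncomputable instance fintype_size (n : ℕ) : Fintype {I : IntervalPoset // I.size = n} :=
  Fintype.ofFinite _

/-- The generating function `Φ(y; x, z) = ∑ y ^ size(I) * x ^ trees(I) * z ^ ir(I)` over all
interval-posets `I`, as a formal power series in `y`. -/
noncomputable def Φ {R : Type*} [CommSemiring R] (x z : R) : PowerSeries R :=
  PowerSeries.mk fun n => ∑ I : {I : IntervalPoset // I.size = n}, x ^ I.1.trees * z ^ I.1.ir

end IntervalPoset

namespace IntervalPoset

/-! ### Roots and children in the final forest -/

/-! `LC` and `IR` are two grammars for the same objects, and `β` translates the first into the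
second. Two facts make this translation a bijection that exchanges the statistics.

First, the statistics obey mirrored recursions. By `trees_LC` and `ir_IR`, trees under `LC` and the
initial rise under `IR` both take the form `s₁ + 1 + (s₂ - r)`. By the lemmas `ir_LC_of_size_…` and
`trees_IR_of_size_…`, the other statistic is in both cases that of the left component, or, if that
component is empty, that of the right component plus one. Structural induction gives `β_statistics`;
in particular `r ≤ trees(I₂)` turns into `r ≤ ir(β(I₂))`, so every `IR` that occurs is legitimate.

Second, both grammars are uniquely readable. For `LC` (`LC_lc` with `lcLeft_LC`, `lcRight_LC`,
`lcNum_LC`), no relation goes from the root or its left to its right, or from the root or its right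
to its left. What remains are relations into the root, and those coming from the right are
determined by an initial segment of the roots there. For `IR` only injectivity (`IR_inj`) is needed,
since there are finitely many interval-posets of each size. The label of the new vertex is the
initial rise of the composite. A tree-counting argument (`not_insertVertex_le_succ`) then forces the
block of inserted labels, and inside the block `ext_of_childCount` recovers `I₂` from its increasing
relations and child counts. Injectivity of `β` follows by structural induction. -/

theorem eq_empty_of_size {I : IntervalPoset} (h : I.size = 0) : I = empty := by
  apply IntervalPoset.ext h
  funext a b
  apply propext
  refine ⟨fun h' => ?_, False.elim⟩
  have := I.mem_of_le _ _ h'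
  omega

theorem rootsUpTo_zero (I : IntervalPoset) : I.rootsUpTo 0 = 0 := by
  simp [rootsUpTo]

open Classical in
theorem rootsUpTo_succ (I : IntervalPoset) (w : ℕ) :
    I.rootsUpTo (w + 1) = I.rootsUpTo w + if I.IsRoot (w + 1) then 1 else 0 := by
  unfold rootsUpTo
  rw [← Finset.insert_Icc_right_eq_Icc_add_one (by omega), Finset.filter_insert]
  split_ifs with h
  · rw [Finset.card_insert_of_notMem (by simp)]
  · rfl

theorem rootsUpTo_succ_of_isRoot {I : IntervalPoset} {w : ℕ} (h : I.IsRoot (w + 1)) :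
    I.rootsUpTo (w + 1) = I.rootsUpTo w + 1 := by
  rw [rootsUpTo_succ, if_pos h]

theorem trees_empty : empty.trees = 0 := rootsUpTo_zero _

theorem ir_empty : empty.ir = 0 := Nat.le_zero.1 empty.ir_le

/-- Discrete intermediate value argument: the count starts at zero and grows by at most one per
label. -/
theorem exists_rootsUpTo_eq (I : IntervalPoset) {r : ℕ} (hr : r ≤ I.trees) :
    ∃ w, w ≤ I.size ∧ I.rootsUpTo w = r := by
  classical
  have key : ∀ n, r ≤ I.rootsUpTo n → ∃ w, w ≤ n ∧ I.rootsUpTo w = r := by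
    intro n
    induction n with
    | zero =>
      intro h
      rw [rootsUpTo_zero] at h
      exact ⟨0, le_rfl, by rw [rootsUpTo_zero]; omega⟩
    | succ n ih =>
      intro h
      by_cases h' : r ≤ I.rootsUpTo n
      · obtain ⟨w, hw, e⟩ := ih h'
        exact ⟨w, by omega, e⟩
      · refine ⟨n + 1, le_rfl, ?_⟩
        rw [rootsUpTo_succ] at h ⊢
        split_ifs at h ⊢ <;> omega
  exact key _ hr

theorem rootsUpTo_lt_of_isRoot {I : IntervalPoset} {v w : ℕ} (hw : I.IsRoot w) (h : v < w) :
    I.rootsUpTo v < I.rootsUpTo w := by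
  obtain ⟨u, rfl⟩ : ∃ u, w = u + 1 := ⟨w - 1, by omega⟩
  rw [rootsUpTo_succ_of_isRoot hw]
  exact Nat.lt_succ_of_le (I.rootsUpTo_mono (by omega))

open Classical in
theorem card_firstRoots (I : IntervalPoset) {r : ℕ} (hr : r ≤ I.trees) :
    ((Finset.Icc 1 I.size).filter fun w => I.IsRoot w ∧ I.rootsUpTo w ≤ r).card = r := by
  obtain ⟨n, hn, rfl⟩ := I.exists_rootsUpTo_eq hr
  conv_rhs => rw [rootsUpTo]
  congr 1
  ext w
  simp only [Finset.mem_filter, Finset.mem_Icc]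
  constructor
  · rintro ⟨h1, h2, h3⟩
    refine ⟨⟨h1.1, ?_⟩, h2⟩
    by_contra h
    have := rootsUpTo_lt_of_isRoot h2 (show n < w by omega)
    omega
  · rintro ⟨h1, h2⟩
    exact ⟨⟨h1.1, by omega⟩, h2, I.rootsUpTo_mono h1.2⟩

theorem belowFirstRoots_iff_of_isRoot {I : IntervalPoset} {r w : ℕ} (hw : I.IsRoot w) :
    I.BelowFirstRoots r w ↔ I.rootsUpTo w ≤ r := by
  constructor
  · rintro ⟨v, h1, h2, h3⟩
    have : w ≤ v := by
      by_contra h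
      exact hw.2.2 v (by omega) h3
    exact (I.rootsUpTo_mono this).trans h2
  · intro h
    exact ⟨w, hw, h, I.refl w hw.1 hw.2.1⟩

theorem size_restrict_right (I : IntervalPoset) (k : ℕ) :
    (I.restrict k I.size).size = I.size - k := by
  simp [restrict]

theorem restrict_right_le_iff (I : IntervalPoset) {k x y : ℕ} (hx : 1 ≤ x) (hy : 1 ≤ y) :
    (I.restrict k I.size).le x y ↔ I.le (x + k) (y + k) := by
  constructor
  · exact fun h => h.2.2.2.2
  · intro h
    have := I.mem_of_le _ _ h
    refine ⟨hx, ?_, hy, ?_, h⟩ <;> omega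

/-- Any label between `k` and a vertex below `k` is itself below `k`, by the `decreasing` axiom.
Hence being a child only requires that nothing to the right of `k` and left of the vertex lies above
it. -/
theorem isChild_add_iff (I : IntervalPoset) {k w : ℕ} (hw : 1 ≤ w) :
    I.IsChild (w + k) k ↔ (I.restrict k I.size).IsRoot w ∧ I.le (w + k) k := by
  constructor
  · rintro ⟨h1, h2, h3⟩
    have hm := I.mem_of_le _ _ h2
    refine ⟨⟨hw, by rw [size_restrict_right]; omega, fun a ha h => ?_⟩, h2⟩
    have ha1 := h.2.2.1
    refine h3 (a + k) (by omega) (by omega) ⟨h.2.2.2.2, ?_⟩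
    exact I.decreasing _ _ _ (by omega) (by omega : a + k < w + k) h2
  · rintro ⟨h1, h2⟩
    refine ⟨by omega, h2, fun i hi hi' h => ?_⟩
    obtain ⟨a, rfl⟩ : ∃ a, i = a + k := ⟨i - k, by omega⟩
    exact h1.2.2 a (by omega) ((I.restrict_right_le_iff hw (by omega)).2 h.1)

open Classical in
/-- The children of `k` are the roots of the subposet of the larger labels that are below `k`. -/
theorem childCount_eq_card_roots (I : IntervalPoset) (k : ℕ) :
    I.childCount k = ((Finset.Icc 1 (I.restrict k I.size).size).filter fun w =>
      (I.restrict k I.size).IsRoot w ∧ I.le (w + k) k).card := by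
  unfold childCount
  symm
  apply Finset.card_bij (fun w _ => w + k)
  · intro w hw
    simp only [Finset.mem_filter, Finset.mem_Icc, size_restrict_right] at hw ⊢
    exact ⟨by omega, (I.isChild_add_iff hw.1.1).2 hw.2⟩
  · intro a _ b _ h
    omega
  · intro j hj
    simp only [Finset.mem_filter, Finset.mem_Icc, size_restrict_right] at hj ⊢
    have h1 := hj.2.1
    obtain ⟨w, rfl⟩ : ∃ w, j = w + k := ⟨j - k, by omega⟩
    exact ⟨w, ⟨by omega, (I.isChild_add_iff (by omega)).1 hj.2⟩, rfl⟩

/-- The converse of `le_of_lt_sum`. -/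
theorem lt_sum_of_le (I : IntervalPoset) {x y m : ℕ} (h : I.le x y) (hym : y ≤ m) (hmx : m < x) :
    m < y + ∑ i ∈ Finset.Icc y m, I.childCount i := by
  classical
  have hm := I.mem_of_le _ _ h
  suffices hs : m + 1 - y ≤ ∑ i ∈ Finset.Icc y m, I.childCount i by omega
  unfold childCount
  rw [← Nat.card_Ioc]
  refine le_trans (Finset.card_le_card ?_) Finset.card_biUnion_le
  intro j hj
  rw [Finset.mem_Ioc] at hj
  have hjy : I.le j y := by
    rcases Nat.eq_or_lt_of_le (show j ≤ x by omega) with e | e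
    · exact e ▸ h
    · exact I.decreasing _ _ _ hj.1 e h
  -- The parent of `j` is the largest smaller label that `j` is below. It lies in `[y, m]`, so every
  -- `j` in `(y, m + 1]` is counted as a child.
  set k := Nat.findGreatest (fun z => I.le j z) (j - 1) with hk
  have h1 : I.le j k := Nat.findGreatest_spec (P := fun z => I.le j z) (m := y) (by omega) hjy
  have h2 : y ≤ k := Nat.le_findGreatest (by omega) hjy
  have h3 : k ≤ j - 1 := Nat.findGreatest_le _
  simp only [Finset.mem_biUnion, Finset.mem_filter, Finset.mem_Icc]
  refine ⟨k, by omega, by omega, by omega, h1, fun i hi hi' h => ?_⟩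
  exact Nat.findGreatest_is_greatest (P := fun z => I.le j z) hi (by omega) h.1

theorem le_iff_lt_sum (I : IntervalPoset) {x y : ℕ} (hy : 1 ≤ y) (hyx : y < x) (hx : x ≤ I.size) :
    I.le x y ↔ ∀ m, y ≤ m → m < x → m < y + ∑ i ∈ Finset.Icc y m, I.childCount i :=
  ⟨fun h _ h1 h2 => I.lt_sum_of_le h h1 h2, I.le_of_lt_sum hy hyx hx⟩

/-- Each vertex is either a root or a child of exactly one vertex. This turns statements about child
counts into statements about `trees`. -/
theorem trees_add_sum_childCount (I : IntervalPoset) :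
    I.trees + ∑ k ∈ Finset.Icc 1 I.size, I.childCount k = I.size := by
  classical
  have hsum : ∑ k ∈ Finset.Icc 1 I.size, I.childCount k =
      ((Finset.Icc 1 I.size).filter fun x => ¬ I.IsRoot x).card := by
    unfold childCount
    rw [← Finset.card_biUnion]
    · congr 1
      ext j
      simp only [Finset.mem_biUnion, Finset.mem_filter, Finset.mem_Icc]
      constructor
      · rintro ⟨k, hk, hj, hc⟩
        exact ⟨hj, fun h => h.2.2 k hc.1 hc.2.1⟩
      · rintro ⟨hj, hr⟩
        unfold IsRoot at hr
        push Not at hr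
        obtain ⟨y, hy, hjy⟩ := hr hj.1 hj.2
        have hm := I.mem_of_le _ _ hjy
        have h1 : I.le j _ :=
          Nat.findGreatest_spec (P := fun z => I.le j z) (n := j - 1) (m := y) (by omega) hjy
        have h2 : y ≤ _ := Nat.le_findGreatest (P := fun z => I.le j z) (n := j - 1) (by omega) hjy
        have h3 := Nat.findGreatest_le (P := fun z => I.le j z) (j - 1)
        refine ⟨_, ⟨?_, ?_⟩, hj, ?_, h1, fun i hi hi' h => ?_⟩
        · omega
        · omega
        · omega
        · exact Nat.findGreatest_is_greatest (P := fun z => I.le j z) hi (by omega) h.1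
    · intro k _ l _ hkl
      rw [Function.onFun, Finset.disjoint_left]
      intro j hj hj'
      simp only [Finset.mem_filter] at hj hj'
      exact hkl (hj.2.unique hj'.2)
  rw [hsum, trees, rootsUpTo, Finset.card_filter_add_card_filter_not]
  simp

/-! ### The initial rise -/

theorem not_le_succ_of_lt_ir (I : IntervalPoset) {j : ℕ} (h : j < I.ir) : ¬ I.le j (j + 1) :=
  (I.mem_ir_iff (by omega) I.ir_le).2 le_rfl j h

theorem ir_eq_of (I : IntervalPoset) {n : ℕ} (h1 : n ≤ I.size)
    (h2 : ∀ j, j < n → ¬ I.le j (j + 1)) (h3 : n = I.size ∨ I.le n (n + 1)) : I.ir = n := by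
  apply le_antisymm
  · by_contra h
    have := I.ir_le
    rcases h3 with h3 | h3
    · omega
    · exact I.not_le_succ_of_lt_ir (by omega) h3
  · rcases Nat.eq_zero_or_pos n with h | h
    · omega
    · exact (I.mem_ir_iff h h1).1 h2

/-! ### The lower contacts decomposition -/

theorem LC_le_left (I₁ I₂ : IntervalPoset) (r : ℕ) {x y : ℕ} (hx : x ≤ I₁.size)
    (hy : y ≤ I₁.size) : (LC I₁ I₂ r).le x y ↔ I₁.le x y := by
  change lcLe I₁ I₂ r x y ↔ _
  unfold lcLe
  constructor
  · rintro (h | h | h | h)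
    · exact h.2.2
    all_goals omega
  · exact fun h => Or.inl ⟨by omega, by omega, h⟩

theorem LC_le_right (I₁ I₂ : IntervalPoset) (r : ℕ) {x y : ℕ} (hx : 1 ≤ x) (hy : 1 ≤ y) :
    (LC I₁ I₂ r).le (x + (I₁.size + 1)) (y + (I₁.size + 1)) ↔ I₂.le x y := by
  change lcLe I₁ I₂ r _ _ ↔ _
  unfold lcLe
  rw [Nat.add_sub_cancel, Nat.add_sub_cancel]
  constructor
  · rintro (h | h | h | h)
    · omega
    · exact h.2.2
    all_goals omega
  · exact fun h => Or.inr (Or.inl ⟨by omega, by omega, h⟩)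

theorem LC_le_root (I₁ I₂ : IntervalPoset) (r : ℕ) {x : ℕ} (hx : 1 ≤ x) :
    (LC I₁ I₂ r).le (x + (I₁.size + 1)) (I₁.size + 1) ↔ I₂.BelowFirstRoots r x := by
  change lcLe I₁ I₂ r _ _ ↔ _
  unfold lcLe
  rw [Nat.add_sub_cancel]
  constructor
  · rintro (h | h | h | h)
    · omega
    · omega
    · omega
    · exact h.2.2
  · exact fun h => Or.inr (Or.inr (Or.inr ⟨by omega, rfl, h⟩))

theorem LC_not_le (I₁ I₂ : IntervalPoset) (r : ℕ) {x y : ℕ} (hx : I₁.size + 1 ≤ x)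
    (hy : y < I₁.size + 1) : ¬ (LC I₁ I₂ r).le x y := by
  change ¬ lcLe I₁ I₂ r _ _
  unfold lcLe
  rintro (h | h | h | h) <;> omega

theorem LC_not_le' (I₁ I₂ : IntervalPoset) (r : ℕ) {x y : ℕ} (hx : x ≤ I₁.size + 1)
    (hy : I₁.size + 1 < y) : ¬ (LC I₁ I₂ r).le x y := by
  change ¬ lcLe I₁ I₂ r _ _
  unfold lcLe
  rintro (h | h | h | h) <;> omega

theorem LC_le_root_of_le (I₁ I₂ : IntervalPoset) (r : ℕ) {x : ℕ} (h1 : 1 ≤ x)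
    (hx : x ≤ I₁.size + 1) : (LC I₁ I₂ r).le x (I₁.size + 1) :=
  Or.inr (Or.inr (Or.inl ⟨h1, hx, rfl⟩))

theorem lcRoot_LC (I₁ I₂ : IntervalPoset) (r : ℕ) : (LC I₁ I₂ r).lcRoot = I₁.size + 1 := by
  classical
  unfold lcRoot
  rw [Nat.findGreatest_eq_iff]
  refine ⟨Nat.le_add_right _ _, fun _ i h1 h2 => LC_le_root_of_le _ _ _ h1 h2.le,
    fun n hn _ h => ?_⟩
  exact LC_not_le' _ _ _ le_rfl hn (h (I₁.size + 1) (by omega) hn)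

theorem lcLeft_LC (I₁ I₂ : IntervalPoset) (r : ℕ) : (LC I₁ I₂ r).lcLeft = I₁ := by
  have hs : min (I₁.size + 1 - 1) (LC I₁ I₂ r).size - 0 = I₁.size := by
    change min (I₁.size + 1 - 1) (I₁.size + 1 + I₂.size) - 0 = _
    omega
  unfold lcLeft
  rw [lcRoot_LC]
  apply IntervalPoset.ext hs
  funext a b
  apply propext
  constructor
  · rintro ⟨h1, h2, h3, h4, h5⟩
    exact (LC_le_left _ _ _ (by omega) (by omega)).1 h5
  · intro h
    have hm := I₁.mem_of_le _ _ h
    exact ⟨hm.1.1, by omega, hm.2.1, by omega, (LC_le_left _ _ _ hm.1.2 hm.2.2).2 h⟩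

theorem lcRight_LC (I₁ I₂ : IntervalPoset) (r : ℕ) : (LC I₁ I₂ r).lcRight = I₂ := by
  unfold lcRight
  rw [lcRoot_LC]
  apply IntervalPoset.ext
  · rw [size_restrict_right]
    exact Nat.add_sub_cancel_left ..
  funext a b
  apply propext
  constructor
  · intro h
    exact (LC_le_right _ _ _ h.1 h.2.2.1).1 h.2.2.2.2
  · intro h
    have hm := I₂.mem_of_le _ _ h
    rw [restrict_right_le_iff _ hm.1.1 hm.2.1, LC_le_right _ _ _ hm.1.1 hm.2.1]
    exact h

/-- The children of the new vertex are the roots of `I₂` placed below it, that is, the first `r`;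
the bound on `r` ensures that there are `r` of them. -/
theorem lcNum_LC (I₁ I₂ : IntervalPoset) {r : ℕ} (hr : r ≤ I₂.trees) :
    (LC I₁ I₂ r).lcNum = r := by
  classical
  have h : (LC I₁ I₂ r).restrict (I₁.size + 1) (LC I₁ I₂ r).size = I₂ := by
    have := lcRight_LC I₁ I₂ r
    rwa [lcRight, lcRoot_LC] at this
  rw [lcNum, lcRoot_LC, childCount_eq_card_roots, h]
  conv_rhs => rw [← I₂.card_firstRoots hr]
  congr 1
  apply Finset.filter_congr
  intro w hw
  rw [Finset.mem_Icc] at hw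
  rw [LC_le_root _ _ _ hw.1]
  exact and_congr_right fun h => belowFirstRoots_iff_of_isRoot h

/-! ### Reconstructing an interval-poset from its lower contacts decomposition -/

theorem isAboveSmaller_lcRoot (I : IntervalPoset) : I.IsAboveSmaller I.lcRoot := by
  classical
  exact Nat.findGreatest_spec (P := I.IsAboveSmaller) (Nat.zero_le _) fun i h1 h2 => by omega

/-- Maximality of the root: such a relation would put the root below `y`, hence also everything
before the root (transitivity) and everything between (`increasing`), so `y` would be a larger
candidate. -/
theorem not_le_of_lcRoot_lt (I : IntervalPoset) {x y : ℕ} (hx : x ≤ I.lcRoot)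
    (hy : I.lcRoot < y) : ¬ I.le x y := by
  classical
  intro h
  have hm := I.mem_of_le _ _ h
  have hk : I.le I.lcRoot y := by
    rcases Nat.eq_or_lt_of_le hx with e | e
    · exact e ▸ h
    · exact I.increasing _ _ _ e hy h
  refine Nat.findGreatest_is_greatest (P := I.IsAboveSmaller) hy hm.2.2 fun i h1 h2 => ?_
  rcases lt_trichotomy i I.lcRoot with e | e | e
  · exact I.trans _ _ _ (I.isAboveSmaller_lcRoot i h1 e) hk
  · exact e ▸ hk
  · exact I.increasing _ _ _ e h2 hk

theorem not_le_of_lt_lcRoot (I : IntervalPoset) {x y : ℕ} (hx : I.lcRoot ≤ x)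
    (hy : y < I.lcRoot) : ¬ I.le x y := by
  intro h
  have hm := I.mem_of_le _ _ h
  have hk : I.le I.lcRoot y := by
    rcases Nat.eq_or_lt_of_le hx with e | e
    · exact e ▸ h
    · exact I.decreasing _ _ _ hy e h
  have := I.antisymm _ _ hk (I.isAboveSmaller_lcRoot y hm.2.1 hy)
  omega

theorem lcNum_le_trees (I : IntervalPoset) : I.lcNum ≤ I.lcRight.trees := by
  classical
  rw [lcNum, childCount_eq_card_roots]
  unfold trees rootsUpTo lcRight
  exact Finset.card_le_card (Finset.monotone_filter_right _ fun _ _ h => h.1)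

/-- By the `decreasing` axiom, the roots of the right part that are below `lcRoot` form an initial
segment of all its roots. There are `lcNum` of them, so the number alone determines which relations
enter the root from the right. -/
theorem belowFirstRoots_lcNum (I : IntervalPoset) {x : ℕ} (hx : 1 ≤ x) :
    I.lcRight.BelowFirstRoots I.lcNum x ↔ I.le (x + I.lcRoot) I.lcRoot := by
  classical
  have hle : ∀ {x y : ℕ}, 1 ≤ x → 1 ≤ y →
      (I.lcRight.le x y ↔ I.le (x + I.lcRoot) (y + I.lcRoot)) := I.restrict_right_le_iff
  have hnum : I.lcNum = ((Finset.Icc 1 I.lcRight.size).filter fun w =>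
      I.lcRight.IsRoot w ∧ I.le (w + I.lcRoot) I.lcRoot).card := I.childCount_eq_card_roots _
  constructor
  · rintro ⟨w, h1, h2, h3⟩
    refine I.trans _ _ _ ((hle hx h1.1).1 h3) ?_
    by_contra hn
    -- If the root `w` is not below `lcRoot`, all `lcNum` children precede `w`, so `w` has rank
    -- greater than `lcNum`.
    have : I.lcNum ≤ I.lcRight.rootsUpTo (w - 1) := by
      rw [hnum]
      apply Finset.card_le_card
      intro v hv
      simp only [Finset.mem_filter, Finset.mem_Icc] at hv ⊢
      refine ⟨⟨hv.1.1, ?_⟩, hv.2.1⟩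
      by_contra hvw
      rcases Nat.eq_or_lt_of_le (show w ≤ v by omega) with e | e
      · exact hn (e ▸ hv.2.2)
      · exact hn (I.decreasing _ _ _ (by have := h1.1; omega) (by omega : w + I.lcRoot < v + _)
          hv.2.2)
    have := rootsUpTo_lt_of_isRoot h1 (show w - 1 < w by have := h1.1; omega)
    omega
  · intro h
    have hm := I.mem_of_le _ _ h
    have hsz : I.lcRight.size = I.size - I.lcRoot := I.size_restrict_right _
    obtain ⟨w, hw, h1, h2⟩ := I.lcRight.exists_root_le x hx (by omega)
    refine ⟨w, h1, ?_, h2⟩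
    rw [hnum]
    apply Finset.card_le_card
    intro v hv
    simp only [Finset.mem_filter, Finset.mem_Icc] at hv ⊢
    refine ⟨by omega, hv.2, ?_⟩
    rcases Nat.eq_or_lt_of_le (show v ≤ x by omega) with e | e
    · exact e ▸ h
    · exact I.decreasing _ _ _ (by omega) (by omega : v + I.lcRoot < x + _) h

theorem LC_lc (I : IntervalPoset) (h : I.size ≠ 0) : LC I.lcLeft I.lcRight I.lcNum = I := by
  have hk1 := I.one_le_lcRoot h
  have hk2 := I.lcRoot_le
  have hsl : I.lcLeft.size + 1 = I.lcRoot := by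
    change min (I.lcRoot - 1) I.size - 0 + 1 = _
    omega
  have hsr : I.lcRight.size = I.size - I.lcRoot := I.size_restrict_right _
  apply IntervalPoset.ext
  · change I.lcLeft.size + 1 + I.lcRight.size = I.size
    omega
  funext x y
  apply propext
  change lcLe _ _ _ x y ↔ _
  unfold lcLe
  rw [hsl]
  constructor
  · rintro (⟨h1, h2, h3⟩ | ⟨h1, h2, h3⟩ | ⟨h1, h2, rfl⟩ | ⟨h1, rfl, h3⟩)
    · exact h3.2.2.2.2
    · have := h3.2.2.2.2
      rwa [Nat.sub_add_cancel h1.le, Nat.sub_add_cancel h2.le] at this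
    · rcases Nat.eq_or_lt_of_le h2 with e | e
      · rw [e]
        exact I.refl _ hk1 hk2
      · exact I.isAboveSmaller_lcRoot x h1 e
    · rw [belowFirstRoots_lcNum _ (by omega), Nat.sub_add_cancel h1.le] at h3
      exact h3
  · intro hxy
    have hm := I.mem_of_le _ _ hxy
    rcases lt_trichotomy y I.lcRoot with hy | hy | hy
    · have hx : x < I.lcRoot := by
        by_contra hx
        exact I.not_le_of_lt_lcRoot (by omega) hy hxy
      exact Or.inl ⟨hx, hy, hm.1.1, by omega, hm.2.1, by omega, hxy⟩
    · subst hy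
      by_cases hx : x ≤ I.lcRoot
      · exact Or.inr (Or.inr (Or.inl ⟨hm.1.1, hx, rfl⟩))
      · refine Or.inr (Or.inr (Or.inr ⟨by omega, rfl, ?_⟩))
        rw [belowFirstRoots_lcNum _ (by omega), Nat.sub_add_cancel (by omega)]
        exact hxy
    · have hx : I.lcRoot < x := by
        by_contra hx
        exact I.not_le_of_lcRoot_lt (by omega) hy hxy
      refine Or.inr (Or.inl ⟨hx, hy, (I.restrict_right_le_iff (by omega) (by omega)).2 ?_⟩)
      rwa [Nat.sub_add_cancel hx.le, Nat.sub_add_cancel hy.le]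

theorem existsUnique_LC (I : IntervalPoset) (h : I.size ≠ 0) :
    ∃! t : IntervalPoset × IntervalPoset × ℕ, t.2.2 ≤ t.2.1.trees ∧ LC t.1 t.2.1 t.2.2 = I := by
  refine ⟨(I.lcLeft, I.lcRight, I.lcNum), ⟨I.lcNum_le_trees, I.LC_lc h⟩, ?_⟩
  rintro ⟨I₁, I₂, r⟩ ⟨hr, rfl⟩
  rw [lcLeft_LC, lcRight_LC, lcNum_LC _ _ hr]

/-! ### Structural induction and the recursion for `β` -/

theorem LC_induction {P : IntervalPoset → Prop} (h0 : P empty)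
    (h : ∀ I₁ I₂ r, r ≤ I₂.trees → P I₁ → P I₂ → P (LC I₁ I₂ r)) (I : IntervalPoset) : P I := by
  induction hn : I.size using Nat.strong_induction_on generalizing I with
  | _ n ih =>
    subst hn
    by_cases hI : I.size = 0
    · exact eq_empty_of_size hI ▸ h0
    · rw [← I.LC_lc hI]
      exact h _ _ _ I.lcNum_le_trees (ih _ (I.size_lcLeft_lt hI) _ rfl)
        (ih _ (I.size_lcRight_lt hI) _ rfl)

theorem β_empty : β empty = empty := by
  rw [β, dif_pos (show empty.size = 0 from rfl)]

theorem β_LC (I₁ I₂ : IntervalPoset) {r : ℕ} (hr : r ≤ I₂.trees) :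
    β (LC I₁ I₂ r) = IR (β I₁) (β I₂) r := by
  have : (LC I₁ I₂ r).size ≠ 0 := by
    change I₁.size + 1 + I₂.size ≠ 0
    omega
  rw [β, dif_neg this]
  simp only [lcLeft_LC, lcRight_LC, lcNum_LC _ _ hr]

/-! ### The statistics of the lower contacts composition -/

theorem isRoot_LC_left (I₁ I₂ : IntervalPoset) (r : ℕ) {x : ℕ} (hx : x ≤ I₁.size) :
    (LC I₁ I₂ r).IsRoot x ↔ I₁.IsRoot x := by
  have hs : (LC I₁ I₂ r).size = I₁.size + 1 + I₂.size := rfl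
  unfold IsRoot
  refine and_congr_right fun _ => ⟨fun h => ⟨hx, fun a ha h' => ?_⟩,
    fun h => ⟨by omega, fun a ha h' => ?_⟩⟩
  · exact h.2 a ha ((LC_le_left _ _ _ hx (by omega)).2 h')
  · exact h.2 a ha ((LC_le_left _ _ _ hx (by omega)).1 h')

theorem isRoot_LC_root (I₁ I₂ : IntervalPoset) (r : ℕ) : (LC I₁ I₂ r).IsRoot (I₁.size + 1) :=
  ⟨Nat.le_add_left _ _, Nat.le_add_right _ _, fun _ ha => LC_not_le _ _ _ le_rfl ha⟩

theorem isRoot_LC_right (I₁ I₂ : IntervalPoset) (r : ℕ) {x : ℕ} (hx : 1 ≤ x) :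
    (LC I₁ I₂ r).IsRoot (x + (I₁.size + 1)) ↔ I₂.IsRoot x ∧ r < I₂.rootsUpTo x := by
  have hs : (LC I₁ I₂ r).size = I₁.size + 1 + I₂.size := rfl
  constructor
  · rintro ⟨h1, h2, h3⟩
    have hr : I₂.IsRoot x := by
      refine ⟨hx, by omega, fun a ha h => ?_⟩
      have hm := I₂.mem_of_le _ _ h
      exact h3 (a + (I₁.size + 1)) (by omega) ((LC_le_right _ _ _ hx hm.2.1).2 h)
    refine ⟨hr, ?_⟩
    by_contra hn
    exact h3 (I₁.size + 1) (by omega) ((LC_le_root _ _ _ hx).2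
      ((belowFirstRoots_iff_of_isRoot hr).2 (by omega)))
  · rintro ⟨h1, h2⟩
    refine ⟨by omega, by have := h1.2.1; omega, fun a ha h => ?_⟩
    rcases lt_trichotomy a (I₁.size + 1) with e | e | e
    · exact LC_not_le _ _ _ (by omega) e h
    · subst e
      rw [LC_le_root _ _ _ hx, belowFirstRoots_iff_of_isRoot h1] at h
      omega
    · obtain ⟨b, rfl⟩ : ∃ b, a = b + (I₁.size + 1) := ⟨a - (I₁.size + 1), by omega⟩
      exact h1.2.2 b (by omega) ((LC_le_right _ _ _ hx (by omega)).1 h)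

theorem rootsUpTo_congr {I J : IntervalPoset} {n : ℕ}
    (h : ∀ x, x ≤ n → (I.IsRoot x ↔ J.IsRoot x)) : I.rootsUpTo n = J.rootsUpTo n := by
  classical
  unfold rootsUpTo
  congr 1
  apply Finset.filter_congr
  intro x hx
  exact h x (Finset.mem_Icc.1 hx).2

theorem trees_LC (I₁ I₂ : IntervalPoset) (r : ℕ) :
    (LC I₁ I₂ r).trees = I₁.trees + 1 + (I₂.trees - r) := by
  -- The truncated difference counts the roots of `I₂` after the first `r`: these are the ones not
  -- absorbed by the new vertex.
  have key : ∀ w, (LC I₁ I₂ r).rootsUpTo (w + (I₁.size + 1)) =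
      I₁.trees + 1 + (I₂.rootsUpTo w - r) := by
    intro w
    induction w with
    | zero =>
      rw [Nat.zero_add, rootsUpTo_succ_of_isRoot (isRoot_LC_root _ _ _), rootsUpTo_zero,
        rootsUpTo_congr (fun x hx => isRoot_LC_left I₁ I₂ r hx), Nat.zero_sub]
      rfl
    | succ w ih =>
      have hr := isRoot_LC_right I₁ I₂ r (show 1 ≤ w + 1 by omega)
      rw [show w + 1 + (I₁.size + 1) = w + (I₁.size + 1) + 1 by omega] at hr ⊢
      classical
      rw [rootsUpTo_succ, if_congr hr rfl rfl, ih, rootsUpTo_succ I₂]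
      by_cases h1 : I₂.IsRoot (w + 1)
      · simp only [h1, true_and, if_true]
        split_ifs <;> omega
      · simp [h1]
  have := key I₂.size
  rw [Nat.add_comm] at this
  exact this

/-- The new vertex is label 1 and is below nothing to its right, so it prolongs the rise of `I₂`. -/
theorem ir_LC_of_size_eq_zero {I₁ : IntervalPoset} (I₂ : IntervalPoset) (r : ℕ)
    (h : I₁.size = 0) : (LC I₁ I₂ r).ir = I₂.ir + 1 := by
  have hs : (LC I₁ I₂ r).size = I₁.size + 1 + I₂.size := rfl
  have hle : ∀ {x y : ℕ}, 1 ≤ x → 1 ≤ y → ((LC I₁ I₂ r).le (x + 1) (y + 1) ↔ I₂.le x y) := by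
    intro x y hx hy
    rw [← LC_le_right I₁ I₂ r hx hy, h]
  have := I₂.ir_le
  apply ir_eq_of
  · omega
  · intro j hj
    by_cases hj1 : j ≤ 1
    · intro h'
      have hm := (LC I₁ I₂ r).mem_of_le _ _ h'
      exact LC_not_le' _ _ _ (by omega) (by omega) h'
    · obtain ⟨i, rfl⟩ : ∃ i, j = i + 1 := ⟨j - 1, by omega⟩
      rw [hle (by omega) (by omega)]
      exact I₂.not_le_succ_of_lt_ir (by omega)
  · by_cases hi : I₂.ir = I₂.size
    · left; omega
    · right
      have h1 := I₂.ir_pos (by omega)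
      exact (hle h1 (by omega)).2 (I₂.le_ir_succ (by omega))

/-- The rise stops inside `I₁`, or else at its last vertex, which is below the new one. -/
theorem ir_LC_of_size_ne_zero {I₁ : IntervalPoset} (I₂ : IntervalPoset) (r : ℕ)
    (h : I₁.size ≠ 0) : (LC I₁ I₂ r).ir = I₁.ir := by
  have hs : (LC I₁ I₂ r).size = I₁.size + 1 + I₂.size := rfl
  have := I₁.ir_le
  have := I₁.ir_pos h
  apply ir_eq_of
  · omega
  · intro j hj
    rw [LC_le_left _ _ _ (by omega) (by omega)]
    exact I₁.not_le_succ_of_lt_ir hj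
  · right
    by_cases hi : I₁.ir = I₁.size
    · rw [hi]
      exact LC_le_root_of_le _ _ _ (by omega) (by omega)
    · rw [LC_le_left _ _ _ (by omega) (by omega)]
      exact I₁.le_ir_succ (by omega)

/-! ### The insertion of a vertex -/

/-- Relabelling of the former vertices after the insertion of a vertex `k`. -/
def shiftPast (k x : ℕ) : ℕ := if x < k then x else x + 1

theorem old_shiftPast (k x : ℕ) : old k (shiftPast k x) = x := by
  unfold old shiftPast
  split_ifs <;> omega

theorem shiftPast_ne (k x : ℕ) : shiftPast k x ≠ k := by
  unfold shiftPast
  split_ifs <;> omega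

theorem shiftPast_lt {k x y : ℕ} (h : x < y) : shiftPast k x < shiftPast k y := by
  unfold shiftPast
  split_ifs <;> omega

theorem one_le_shiftPast {k x : ℕ} (h : 1 ≤ x) : 1 ≤ shiftPast k x := by
  unfold shiftPast
  split_ifs <;> omega

theorem shiftPast_le {k x n : ℕ} (h : x ≤ n) : shiftPast k x ≤ n + 1 := by
  unfold shiftPast
  split_ifs <;> omega

theorem insertVertex_le_shiftPast (I : IntervalPoset) (r : ℕ) {x y : ℕ} (h : x < y) :
    (I.insertVertex r).le (shiftPast (I.insertPos r) x) (shiftPast (I.insertPos r) y) ↔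
      I.le x y := by
  have hlt := shiftPast_lt (k := I.insertPos r) h
  constructor
  · rintro ⟨-, -, -, -, h1 | h1 | h1⟩
    · omega
    · have := h1.2.2
      rwa [old_shiftPast, old_shiftPast] at this
    · omega
  · intro hxy
    have hm := I.mem_of_le _ _ hxy
    refine ⟨one_le_shiftPast hm.1.1, shiftPast_le hm.1.2, one_le_shiftPast hm.2.1,
      shiftPast_le hm.2.2, Or.inr (Or.inl ⟨hlt, shiftPast_ne _ _, ?_⟩)⟩
    rwa [old_shiftPast, old_shiftPast]

theorem childCount_insertVertex_shiftPast (I : IntervalPoset) (r : ℕ) {x : ℕ} (h1 : 1 ≤ x)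
    (h2 : x ≤ I.size) :
    (I.insertVertex r).childCount (shiftPast (I.insertPos r) x) = I.childCount x := by
  rw [I.childCount_insertVertex r (one_le_shiftPast h1) (shiftPast_le h2), insertCount,
    if_neg (shiftPast_ne _ _), old_shiftPast]

/-- The labels before the new vertex belong to the initial rise of `I`, and the added relation stops
the rise at the new vertex. The insertion position can therefore be read off from the result. -/
theorem ir_insertVertex (I : IntervalPoset) (r : ℕ) :
    (I.insertVertex r).ir = I.insertPos r := by
  have hk1 := I.one_le_insertPos r
  have hk2 := I.insertPos_le r
  have hir : I.insertPos r = I.ir - r + 1 := rfl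
  have hs : (I.insertVertex r).size = I.size + 1 := rfl
  apply ir_eq_of
  · omega
  · rintro j hj ⟨-, -, -, -, h | h | h⟩
    · omega
    · have h1 := h.2.2
      rw [old, if_pos hj.le, old, if_pos (by omega)] at h1
      exact I.not_le_succ_of_lt_ir (by omega) h1
    · omega
  · by_cases h : I.insertPos r = I.size + 1
    · exact Or.inl h
    · right
      refine ⟨hk1, hk2, by omega, by omega, Or.inr (Or.inl ⟨by omega, by omega, ?_⟩)⟩
      -- The new vertex and its successor have the same value of `old`, so the added relation is
      -- reflexivity in `I`.
      rw [old, if_pos le_rfl, old, if_neg (by omega)]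
      exact I.refl _ hk1 (by omega)

/-- There is one more vertex but the total number of children is unchanged. -/
theorem trees_insertVertex (I : IntervalPoset) (r : ℕ) :
    (I.insertVertex r).trees = I.trees + 1 := by
  have h1 := I.trees_add_sum_childCount
  have h2 := (I.insertVertex r).trees_add_sum_childCount
  have hs : (I.insertVertex r).size = I.size + 1 := rfl
  have h3 : ∑ k ∈ Finset.Icc 1 (I.size + 1), (I.insertVertex r).childCount k =
      ∑ k ∈ Finset.Icc 1 (I.size + 1), I.insertCount (I.insertPos r) k := by
    apply Finset.sum_congr rfl
    intro i hi
    rw [Finset.mem_Icc] at hi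
    exact I.childCount_insertVertex r hi.1 hi.2
  rw [hs, h3, I.sum_insertCount_of_mem (I.one_le_insertPos r) (I.insertPos_le r)] at h2
  omega

/-- An interval-poset is determined by its increasing relations and the numbers of children. -/
theorem ext_of_childCount {I J : IntervalPoset} (hs : I.size = J.size)
    (hinc : ∀ x y, x < y → (I.le x y ↔ J.le x y))
    (hc : ∀ x, 1 ≤ x → x ≤ I.size → I.childCount x = J.childCount x) : I = J := by
  apply IntervalPoset.ext hs
  funext x y
  apply propext
  by_cases hxy : (1 ≤ x ∧ x ≤ I.size) ∧ 1 ≤ y ∧ y ≤ I.size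
  · rcases lt_trichotomy x y with h | h | h
    · exact hinc x y h
    · subst h
      exact iff_of_true (I.refl _ hxy.1.1 hxy.1.2) (J.refl _ hxy.1.1 (hs ▸ hxy.1.2))
    · rw [I.le_iff_lt_sum hxy.2.1 h hxy.1.2, J.le_iff_lt_sum hxy.2.1 h (hs ▸ hxy.1.2)]
      refine forall_congr' fun m => forall_congr' fun h1 => forall_congr' fun h2 => ?_
      rw [Finset.sum_congr rfl fun i hi => ?_]
      rw [Finset.mem_Icc] at hi
      exact hc i (by omega) (by omega)
  · refine iff_of_false (fun h => hxy (I.mem_of_le _ _ h)) fun h => hxy ?_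
    rw [hs]
    exact J.mem_of_le _ _ h

theorem insertVertex_inj {I J : IntervalPoset} {r s : ℕ} (hr : r ≤ I.ir) (hs : s ≤ J.ir)
    (h : I.insertVertex r = J.insertVertex s) : I = J ∧ r = s := by
  have hk : I.insertPos r = J.insertPos s := by
    rw [← ir_insertVertex, ← ir_insertVertex, h]
  have hsize : I.size = J.size := by
    have : I.size + 1 = J.size + 1 := congrArg size h
    omega
  have hIJ : I = J := by
    apply ext_of_childCount hsize
    · intro x y hxy
      rw [← I.insertVertex_le_shiftPast r hxy, ← J.insertVertex_le_shiftPast s hxy, h, hk]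
    · intro x h1 h2
      rw [← I.childCount_insertVertex_shiftPast r h1 h2,
        ← J.childCount_insertVertex_shiftPast s h1 (hsize ▸ h2), h, hk]
  refine ⟨hIJ, ?_⟩
  subst hIJ
  unfold insertPos at hk
  omega

/-- If `p` is smaller than the inserted vertex `k` and has all the vertices up to some `x ≥ k` as
descendants, then the vertex `x + 1` cannot be the first one that `p` is below. -/
theorem not_insertVertex_le_succ (I : IntervalPoset) (r : ℕ) {p x : ℕ} (hp : p < I.insertPos r)
    (hx : I.insertPos r ≤ x) (h : (I.insertVertex r).le x p) :
    x ≤ I.size ∧ ¬ (I.insertVertex r).le p (x + 1) := by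
  obtain ⟨h1, h2, h3, h4, h5⟩ := h
  have h5 : ∀ m, p ≤ m → m < x →
      m < p + ∑ i ∈ Finset.Icc p m, I.insertCount (I.insertPos r) i := by
    rcases h5 with h5 | h5 | h5
    · omega
    · omega
    · exact h5.2
  -- Deletion of the childless new vertex: past it, the labels `p, …, m` of `I` carry the counts of
  -- the new labels `p, …, m + 1`, so the inequalities persist. The subtree of `p` loses a leaf but
  -- no child count, hence must absorb the next vertex, which has former label `x`.
  have hsum : ∀ m, p ≤ m → m < x → m < p + ∑ i ∈ Finset.Icc p m, I.childCount i := by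
    intro m hm1 hm2
    by_cases hmk : m < I.insertPos r
    · rw [← I.sum_insertCount_of_lt hmk]
      exact h5 m hm1 hm2
    · rw [← I.sum_insertCount_of_mem hp.le (by omega)]
      refine (h5 m hm1 hm2).trans_le (Nat.add_le_add_left ?_ _)
      exact Finset.sum_le_sum_of_subset (Finset.Icc_subset_Icc_right (by omega))
  have hxs : x ≤ I.size := by
    by_contra hn
    -- If `x` were the last label, `p` would need a vertex beyond the end of `I`: too many children
    -- for the labels available.
    have e1 := hsum (x - 1) (by omega) (by omega)
    have e2 := I.sum_childCount_le p I.size fun j k _ _ h => (I.mem_of_le _ _ h.2.1).1.2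
    rw [show x - 1 = I.size by omega] at e1
    omega
  refine ⟨hxs, fun h => ?_⟩
  have e1 := I.le_of_lt_sum h3 (by omega) hxs hsum
  obtain ⟨-, -, -, -, h6 | h6 | h6⟩ := h
  · omega
  · have e2 := h6.2.2
    rw [old, if_pos hp.le, old, if_neg (by omega), Nat.add_sub_cancel] at e2
    have := I.antisymm _ _ e1 e2
    omega
  · omega

/-! ### Merging -/

/-- Relabelling of the former vertices after the insertion of `m` labels right after `a`. -/
def newMerge (a m x : ℕ) : ℕ := if x ≤ a then x else x + m

theorem oldMerge_newMerge (a m x : ℕ) : oldMerge a m (newMerge a m x) = x := by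
  unfold oldMerge newMerge
  split_ifs <;> omega

theorem not_inserted_newMerge (a m x : ℕ) : ¬ Inserted a m (newMerge a m x) := by
  unfold Inserted newMerge
  split_ifs <;> omega

theorem newMerge_oldMerge {a m x : ℕ} (h : ¬ Inserted a m x) :
    newMerge a m (oldMerge a m x) = x := by
  unfold Inserted at h
  unfold oldMerge newMerge
  split_ifs <;> omega

theorem newMerge_lt_iff {a m x y : ℕ} : newMerge a m x < newMerge a m y ↔ x < y := by
  unfold newMerge
  split_ifs <;> omega

theorem inserted_add {a m x : ℕ} (h1 : 1 ≤ x) (h2 : x ≤ m) : Inserted a m (x + a) := by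
  unfold Inserted
  omega

theorem merge_le_newMerge (I J : IntervalPoset) (x y : ℕ) :
    (I.merge J).le (newMerge I.ir J.size x) (newMerge I.ir J.size y) ↔ I.le x y := by
  change mergeLe _ _ _ _ ↔ _
  simp only [mergeLe, not_inserted_newMerge, oldMerge_newMerge, not_false_eq_true, true_and,
    false_and, or_false]

theorem merge_le_add (I J : IntervalPoset) {x y : ℕ} (hx : 1 ≤ x) (hx' : x ≤ J.size) (hy : 1 ≤ y)
    (hy' : y ≤ J.size) : (I.merge J).le (x + I.ir) (y + I.ir) ↔ J.le x y := by
  change mergeLe _ _ _ _ ↔ _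
  simp only [mergeLe, inserted_add hx hx', inserted_add hy hy', Nat.add_sub_cancel, not_true,
    true_and, false_and, false_or, or_false]

theorem merge_le_add_newMerge (I J : IntervalPoset) {x : ℕ} (hx : 1 ≤ x) (hx' : x ≤ J.size)
    (y : ℕ) : (I.merge J).le (x + I.ir) (newMerge I.ir J.size y) ↔ I.le I.ir y := by
  change mergeLe _ _ _ _ ↔ _
  simp only [mergeLe, inserted_add hx hx', not_inserted_newMerge, oldMerge_newMerge, not_true,
    not_false_eq_true, true_and, false_and, false_or]

theorem not_merge_le_of_inserted (I J : IntervalPoset) {x y : ℕ} (hx : ¬ Inserted I.ir J.size x)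
    (hy : Inserted I.ir J.size y) : ¬ (I.merge J).le x y := by
  rintro (h | h | h)
  · exact h.2.1 hy
  · exact hx h.1
  · exact h.2.1 hy

theorem isRoot_merge_newMerge (I J : IntervalPoset) (x : ℕ) :
    (I.merge J).IsRoot (newMerge I.ir J.size x) ↔ I.IsRoot x := by
  have hs : (I.merge J).size = I.size + J.size := rfl
  have hir := I.ir_le
  have h1 : (1 ≤ newMerge I.ir J.size x ∧ newMerge I.ir J.size x ≤ I.size + J.size) ↔
      (1 ≤ x ∧ x ≤ I.size) := by
    unfold newMerge
    split_ifs <;> omega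
  unfold IsRoot
  rw [← and_assoc, ← and_assoc, hs, h1]
  refine and_congr_right fun _ => ⟨fun h a ha h' => ?_, fun h a ha h' => ?_⟩
  · exact h _ (newMerge_lt_iff.2 ha) ((I.merge_le_newMerge J x a).2 h')
  · by_cases hI : Inserted I.ir J.size a
    · exact I.not_merge_le_of_inserted J (not_inserted_newMerge _ _ _) hI h'
    · rw [← newMerge_oldMerge hI] at ha h'
      exact h _ (newMerge_lt_iff.1 ha) ((I.merge_le_newMerge J _ _).1 h')

theorem not_isRoot_merge_of_inserted (I J : IntervalPoset) (hI : I.size ≠ 0) {x : ℕ}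
    (h : Inserted I.ir J.size x) : ¬ (I.merge J).IsRoot x := by
  intro hr
  obtain ⟨j, rfl⟩ : ∃ j, x = j + I.ir := ⟨x - I.ir, by unfold Inserted at h; omega⟩
  unfold Inserted at h
  have h1 := I.ir_pos hI
  refine hr.2.2 I.ir (by omega) ?_
  have := (I.merge_le_add_newMerge J (x := j) (by omega) (by omega) I.ir).2
    (I.refl _ h1 I.ir_le)
  rwa [newMerge, if_pos le_rfl] at this

/-- Inserted vertices are below the smaller label `I.ir`, hence are not roots, and no former vertex
becomes related to an inserted one above it. -/
theorem trees_merge (I J : IntervalPoset) (hI : I.size ≠ 0) : (I.merge J).trees = I.trees := by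
  classical
  unfold trees rootsUpTo
  symm
  apply Finset.card_bij (fun x _ => newMerge I.ir J.size x)
  · intro x hx
    rw [Finset.mem_filter] at hx ⊢
    have hr := (I.isRoot_merge_newMerge J x).2 hx.2
    exact ⟨Finset.mem_Icc.2 ⟨hr.1, hr.2.1⟩, hr⟩
  · intro x _ y _ h
    rw [← oldMerge_newMerge I.ir J.size x, h, oldMerge_newMerge]
  · intro x hx
    rw [Finset.mem_filter] at hx
    have hn : ¬ Inserted I.ir J.size x := fun h => I.not_isRoot_merge_of_inserted J hI h hx.2
    have hr := hx.2
    rw [← newMerge_oldMerge hn, isRoot_merge_newMerge] at hr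
    exact ⟨_, Finset.mem_filter.2 ⟨Finset.mem_Icc.2 ⟨hr.1, hr.2.1⟩, hr⟩, newMerge_oldMerge hn⟩

/-- The block separates `I.ir` from its old successor, so the rise continues through `J`. It stops
inside `J`, or at the last vertex of `J`, which is below the next vertex of `I` if there is one. -/
theorem ir_merge (I J : IntervalPoset) (hJ : J.size ≠ 0) : (I.merge J).ir = I.ir + J.ir := by
  have hs : (I.merge J).size = I.size + J.size := rfl
  have h1 := I.ir_le
  have h2 := J.ir_le
  have h3 := J.ir_pos hJ
  apply ir_eq_of
  · omega
  · intro j hj h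
    rcases lt_trichotomy j I.ir with e | e | e
    · have := I.merge_le_newMerge J j (j + 1)
      rw [newMerge, newMerge, if_pos e.le, if_pos (by omega)] at this
      exact I.not_le_succ_of_lt_ir e (this.1 h)
    · refine I.not_merge_le_of_inserted J ?_ ?_ h <;> (unfold Inserted; omega)
    · obtain ⟨i, rfl⟩ : ∃ i, j = i + I.ir := ⟨j - I.ir, by omega⟩
      rw [show i + I.ir + 1 = i + 1 + I.ir by omega,
        I.merge_le_add J (by omega) (by omega) (by omega) (by omega)] at h
      exact J.not_le_succ_of_lt_ir (by omega) h
  · by_cases hj : J.ir = J.size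
    · by_cases hi : I.ir = I.size
      · left; omega
      · right
        have := (I.merge_le_add_newMerge J h3 h2 (I.ir + 1)).2 (I.le_ir_succ (by omega))
        rw [newMerge, if_neg (by omega)] at this
        rwa [Nat.add_comm I.ir, show J.ir + I.ir + 1 = I.ir + 1 + J.size by omega]
    · right
      rw [show I.ir + J.ir + 1 = J.ir + 1 + I.ir by omega, Nat.add_comm I.ir,
        I.merge_le_add J h3 h2 (by omega) (by omega)]
      exact J.le_ir_succ (by omega)

theorem empty_merge (J : IntervalPoset) : empty.merge J = J := by
  have hs : (empty.merge J).size = J.size := Nat.zero_add _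
  apply IntervalPoset.ext hs
  funext x y
  apply propext
  by_cases hxy : (1 ≤ x ∧ x ≤ J.size) ∧ 1 ≤ y ∧ y ≤ J.size
  · have := empty.merge_le_add J hxy.1.1 hxy.1.2 hxy.2.1 hxy.2.2
    rwa [ir_empty] at this
  · refine iff_of_false (fun h => hxy ?_) fun h => hxy (J.mem_of_le _ _ h)
    rw [← hs]
    exact mem_of_le _ _ _ h

/-! ### The initial rise composition -/

theorem size_IR (I₁ I₂ : IntervalPoset) (r : ℕ) :
    (IR I₁ I₂ r).size = I₁.size + (I₂.size + 1) := rfl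

theorem ir_IR (I₁ I₂ : IntervalPoset) (r : ℕ) :
    (IR I₁ I₂ r).ir = I₁.ir + 1 + (I₂.ir - r) := by
  have : (I₂.insertVertex r).size ≠ 0 := Nat.succ_ne_zero _
  rw [IR, ir_merge _ _ this, ir_insertVertex, insertPos]
  omega

theorem trees_IR_of_size_eq_zero {I₁ : IntervalPoset} (I₂ : IntervalPoset) (r : ℕ)
    (h : I₁.size = 0) : (IR I₁ I₂ r).trees = I₂.trees + 1 := by
  rw [IR, eq_empty_of_size h, empty_merge, trees_insertVertex]

theorem trees_IR_of_size_ne_zero {I₁ : IntervalPoset} (I₂ : IntervalPoset) (r : ℕ)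
    (h : I₁.size ≠ 0) : (IR I₁ I₂ r).trees = I₁.trees :=
  trees_merge _ _ h

/-! ### Unique readability of the initial rise composition -/

theorem merge_le_ir (I J : IntervalPoset) (hI : I.size ≠ 0) {x : ℕ}
    (hx : Inserted I.ir J.size x) : (I.merge J).le x I.ir := by
  obtain ⟨j, rfl⟩ : ∃ j, x = j + I.ir := ⟨x - I.ir, by unfold Inserted at hx; omega⟩
  unfold Inserted at hx
  have := (I.merge_le_add_newMerge J (x := j) (by omega) (by omega) I.ir).2
    (I.refl _ (I.ir_pos hI) I.ir_le)
  rwa [newMerge, if_pos le_rfl] at this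

theorem merge_ir_le (I J : IntervalPoset) (hI : I.ir < I.size) :
    (I.merge J).le I.ir (I.ir + J.size + 1) := by
  have := (I.merge_le_newMerge J _ _).2 (I.le_ir_succ hI)
  rw [newMerge, newMerge, if_pos le_rfl, if_neg (by omega)] at this
  rwa [show I.ir + J.size + 1 = I.ir + 1 + J.size by omega]

/-- Suppose the second block starts later. Then `J₁.ir` lies in the first block, before the new
vertex, and the last vertex of the second block is below it. By `not_insertVertex_le_succ` the first
block extends further and `J₁.ir` is not below the next vertex, whereas in the second reading it is.
-/
theorem ir_le_ir_of_IR_eq {I₁ I₂ J₁ J₂ : IntervalPoset} {r s : ℕ}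
    (h : IR I₁ I₂ r = IR J₁ J₂ s) : J₁.ir ≤ I₁.ir := by
  have hpI := I₂.insertPos_le r
  have hpJ := J₂.one_le_insertPos s
  have hpJ' := J₂.insertPos_le s
  have hJ := J₁.ir_le
  have hI := I₁.ir_le
  have hsI : (I₂.insertVertex r).size = I₂.size + 1 := rfl
  have hsJ : (J₂.insertVertex s).size = J₂.size + 1 := rfl
  have hsize : I₁.size + (I₂.size + 1) = J₁.size + (J₂.size + 1) := congrArg size h
  -- Both readings place the new vertex at the same label, the initial rise of the composite.
  have hv : I₁.ir + I₂.insertPos r = J₁.ir + J₂.insertPos s := by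
    have := congrArg ir h
    rw [ir_IR, ir_IR] at this
    unfold insertPos
    omega
  by_contra hlt
  obtain ⟨p, hp⟩ : ∃ p, J₁.ir = p + I₁.ir := ⟨J₁.ir - I₁.ir, by omega⟩
  have hle : (IR I₁ I₂ r).le (J₁.ir + (J₂.size + 1)) J₁.ir := by
    rw [h]
    exact merge_le_ir _ _ (by omega) ⟨by omega, by omega⟩
  -- The end of the second block cannot lie beyond the first block, since vertices outside a block
  -- are never below vertices inside.
  by_cases hx : I₂.size + 1 + I₁.ir < J₁.ir + (J₂.size + 1)
  · refine not_merge_le_of_inserted _ _ ?_ ?_ hle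
    · unfold Inserted; omega
    · unfold Inserted; omega
  obtain ⟨x, hx⟩ : ∃ x, J₁.ir + (J₂.size + 1) = x + I₁.ir :=
    ⟨J₁.ir + (J₂.size + 1) - I₁.ir, by omega⟩
  rw [hx, hp, IR, merge_le_add _ _ (by omega) (by omega) (by omega) (by omega)] at hle
  obtain ⟨h1, h2⟩ := I₂.not_insertVertex_le_succ r (p := p) (x := x) (by omega) (by omega) hle
  have hle' : (IR I₁ I₂ r).le J₁.ir (J₁.ir + (J₂.size + 1) + 1) := by
    rw [h]
    exact merge_ir_le _ _ (by omega)
  rw [hx, show x + I₁.ir + 1 = x + 1 + I₁.ir by omega, hp, IR,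
    merge_le_add _ _ (by omega) (by omega) (by omega) (by omega)] at hle'
  exact h2 hle'

/-- The blocks start at the same place. If the first were shorter, the vertex after it, which is
above `I₁.ir`, would lie inside the second block, where nothing outside can be below it. -/
theorem size_le_size_of_IR_eq {I₁ I₂ J₁ J₂ : IntervalPoset} {r s : ℕ}
    (h : IR I₁ I₂ r = IR J₁ J₂ s) : J₂.size ≤ I₂.size := by
  have hir : I₁.ir = J₁.ir := le_antisymm (ir_le_ir_of_IR_eq h.symm) (ir_le_ir_of_IR_eq h)
  have hJ := J₁.ir_le
  have hI := I₁.ir_le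
  have hsI : (I₂.insertVertex r).size = I₂.size + 1 := rfl
  have hsJ : (J₂.insertVertex s).size = J₂.size + 1 := rfl
  have hsize : I₁.size + (I₂.size + 1) = J₁.size + (J₂.size + 1) := congrArg size h
  by_contra hlt
  have hle : (IR I₁ I₂ r).le I₁.ir (I₁.ir + (I₂.size + 1) + 1) := merge_ir_le _ _ (by omega)
  rw [h] at hle
  refine not_merge_le_of_inserted _ _ ?_ ?_ hle
  · unfold Inserted; omega
  · unfold Inserted; omega

theorem IR_inj {I₁ I₂ J₁ J₂ : IntervalPoset} {r s : ℕ} (hr : r ≤ I₂.ir) (hs : s ≤ J₂.ir)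
    (h : IR I₁ I₂ r = IR J₁ J₂ s) : I₁ = J₁ ∧ I₂ = J₂ ∧ r = s := by
  have hir : I₁.ir = J₁.ir := le_antisymm (ir_le_ir_of_IR_eq h.symm) (ir_le_ir_of_IR_eq h)
  have hsz : I₂.size = J₂.size :=
    le_antisymm (size_le_size_of_IR_eq h.symm) (size_le_size_of_IR_eq h)
  have hsI : (I₂.insertVertex r).size = I₂.size + 1 := rfl
  have hsJ : (J₂.insertVertex s).size = J₂.size + 1 := rfl
  have hsize : I₁.size + (I₂.size + 1) = J₁.size + (J₂.size + 1) := congrArg size h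
  constructor
  · apply IntervalPoset.ext (by omega)
    funext x y
    apply propext
    rw [← I₁.merge_le_newMerge (I₂.insertVertex r), ← J₁.merge_le_newMerge (J₂.insertVertex s),
      hir, hsI, hsJ, hsz]
    change (IR I₁ I₂ r).le _ _ ↔ (IR J₁ J₂ s).le _ _
    rw [h]
  · apply insertVertex_inj hr hs
    apply IntervalPoset.ext (by omega)
    funext x y
    apply propext
    by_cases hxy : (1 ≤ x ∧ x ≤ I₂.size + 1) ∧ 1 ≤ y ∧ y ≤ I₂.size + 1
    · rw [← I₁.merge_le_add (I₂.insertVertex r) hxy.1.1 hxy.1.2 hxy.2.1 hxy.2.2,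
        ← J₁.merge_le_add (J₂.insertVertex s) hxy.1.1 (by omega) hxy.2.1 (by omega), hir]
      change (IR I₁ I₂ r).le _ _ ↔ (IR J₁ J₂ s).le _ _
      rw [h]
    · refine iff_of_false (fun h => hxy (mem_of_le _ _ _ h)) fun h => hxy ?_
      have := mem_of_le _ _ _ h
      omega

/-! ### The map `β` -/

theorem β_statistics (I : IntervalPoset) :
    I.β.size = I.size ∧ I.β.trees = I.ir ∧ I.β.ir = I.trees := by
  induction I using LC_induction with
  | h0 => rw [β_empty, trees_empty, ir_empty]; exact ⟨rfl, rfl, rfl⟩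
  | h I₁ I₂ r hr ih₁ ih₂ =>
    have hs : (LC I₁ I₂ r).size = I₁.size + 1 + I₂.size := rfl
    rw [β_LC _ _ hr]
    refine ⟨?_, ?_, ?_⟩
    · rw [size_IR, ih₁.1, ih₂.1]
      omega
    · by_cases h : I₁.size = 0
      · rw [trees_IR_of_size_eq_zero _ _ (ih₁.1.trans h), ir_LC_of_size_eq_zero _ _ h, ih₂.2.1]
      · rw [trees_IR_of_size_ne_zero _ _ (ih₁.1.trans_ne h), ir_LC_of_size_ne_zero _ _ h, ih₁.2.1]
    · rw [ir_IR, trees_LC, ih₁.2.2, ih₂.2.2]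

theorem β_injective : Function.Injective β := by
  intro I
  induction I using LC_induction with
  | h0 =>
    intro J h
    have := congrArg size h
    rw [(β_statistics _).1, (β_statistics _).1] at this
    exact (eq_empty_of_size this.symm).symm
  | h I₁ I₂ r hr ih₁ ih₂ =>
    intro J h
    have hs : (LC I₁ I₂ r).size = I₁.size + 1 + I₂.size := rfl
    have hJ := congrArg size h
    rw [(β_statistics _).1, (β_statistics _).1] at hJ
    have hlc := J.LC_lc (by omega)
    have hn := J.lcNum_le_trees
    rw [← hlc, β_LC _ _ hr, β_LC _ _ hn] at h
    -- The exchange of statistics converts the `LC` bounds by `trees` into the `IR` bounds by `ir`.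
    obtain ⟨h1, h2, h3⟩ := IR_inj (hr.trans_eq (β_statistics _).2.2.symm)
      (hn.trans_eq (β_statistics _).2.2.symm) h
    rw [← hlc, ih₁ h1, ih₂ h2, h3]

theorem bijOn_β (n : ℕ) :
    Set.BijOn β {I : IntervalPoset | I.size = n} {I : IntervalPoset | I.size = n} := by
  have hmap : Set.MapsTo β {I : IntervalPoset | I.size = n} {I : IntervalPoset | I.size = n} :=
    fun I hI => (β_statistics I).1.trans hI
  have hfin : {I : IntervalPoset | I.size = n}.Finite := finite_size n
  exact (hfin.injOn_iff_bijOn_of_mapsTo hmap).1 β_injective.injOn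

theorem Φ_symm {R : Type*} [CommSemiring R] (x z : R) : Φ x z = Φ z x := by
  unfold Φ
  congr 1
  funext n
  let e : {I : IntervalPoset // I.size = n} ≃ {I : IntervalPoset // I.size = n} :=
    (bijOn_β n).equiv β
  rw [← Equiv.sum_comp e]
  apply Finset.sum_congr rfl
  intro I _
  have he : (e I).1 = I.1.β := rfl
  rw [he, (β_statistics _).2.1, (β_statistics _).2.2, mul_comm]

end IntervalPoset

theorem mainTheorem1 :
    -- every non-empty interval-poset has a unique lower contacts decomposition
    (∀ I : IntervalPoset, I.size ≠ 0 →
      ∃! t : IntervalPoset × IntervalPoset × ℕ,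
        t.2.2 ≤ t.2.1.trees ∧ IntervalPoset.LC t.1 t.2.1 t.2.2 = I) ∧
    -- the recursive definition of the map β; the composition on the right is a legitimate one
    IntervalPoset.β IntervalPoset.empty = IntervalPoset.empty ∧
    (∀ (I₁ I₂ : IntervalPoset) (r : ℕ), r ≤ I₂.trees →
      r ≤ I₂.β.ir ∧
        IntervalPoset.β (IntervalPoset.LC I₁ I₂ r) = IntervalPoset.IR I₁.β I₂.β r) ∧
    -- β is a bijection on the interval-posets of each size
    (∀ n : ℕ, Set.BijOn IntervalPoset.β
      {I : IntervalPoset | I.size = n} {I : IntervalPoset | I.size = n}) ∧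
    -- β exchanges the two statistics
    (∀ I : IntervalPoset, I.β.trees = I.ir ∧ I.β.ir = I.trees) ∧
    -- the symmetry of the generating function
    (∀ (R : Type*) [CommSemiring R] (x z : R),
      IntervalPoset.Φ x z = IntervalPoset.Φ z x) := by
  refine ⟨IntervalPoset.existsUnique_LC, IntervalPoset.β_empty, fun I₁ I₂ r hr => ⟨?_, ?_⟩,
    IntervalPoset.bijOn_β, fun I => (IntervalPoset.β_statistics I).2,
    fun R _ x z => IntervalPoset.Φ_symm x z⟩
  · exact hr.trans_eq (IntervalPoset.β_statistics I₂).2.2.symm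
  · exact IntervalPoset.β_LC I₁ I₂ hr
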